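/- **Conventions.** Let $L_0$ be a language with one binary relation symbol $E$. Consider three classes of finite $L_0$-structures (the empty structure is allowed): $\mathbf{LO}$, the finite strict linear orders; $\mathbf{T}$, the finite tournaments ($E$ is irreflexive and, for all distinct $a,b$, exactly one of $E(a,b)$, $E(b,a)$ holds); and $\mathbf{G}$, the finite graphs ($E$ is irreflexive and symmetric). For classes $\mathbf{K}_0,\mathbf{K}_1$ of finite structures in relational languages $L_0, L_1$, the free superposition $\mathbf{K}_0 * \mathbf{K}_1$ is the class of all finite structures in the disjoint union of $L_0$ and $L_1$ whose reduct to $L_t$ lies in $\mathbf{K}_t$ for $t=0,1$. Put $\mathbf{K}^{*1}=\mathbf{K}$ and $\mathbf{K}^{*(m+1)}=\mathbf{K}^{*m}*\mathbf{K}$ for $m \ge 1$. Let $T$ be the theory of the random graph, in the language $L$ with one binary relation symbol: $T$ is axiomatized by the axioms of graphs together with, for all $k,l<\omega$, the axiom saying that for all $x_0,\dots,x_{k-1},y_0,\dots,y_{l-1}$ with $x_i\ne y_j$ for all $i,j$, there is $z$ adjacent to every $x_i$, and different from and not adjacent to every $y_j$. Let $\mathfrak{C}$ be any $\aleph_1$-saturated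 model of $T$. Let $n \ge 1$. For a Fraïssé class $\mathbf{K}$ in a finite relational language, with Fraïssé limit $\Gamma$, a $\mathbf{K}$-configuration into $\mathfrak{C}^n$ is a function $f:\Gamma\to\mathfrak{C}^n$ such that for every relation symbol $R$ of the language of $\mathbf{K}$, of arity $k$, there is an $L$-formula $\varphi_R(\overline y_0,\dots,\overline y_{k-1})$ with parameters from $\mathfrak{C}$ such that for all $a_0,\dots,a_{k-1}\in\Gamma$, $$\Gamma\models R(a_0,\dots,a_{k-1}) \iff \mathfrak{C}\models\varphi_R(f(a_0),\dots,f(a_{k-1})).$$ For $\mathbf{K}\in\{\mathbf{LO},\mathbf{T},\mathbf{G}\}$, the rank $\mathrm{Rk}_{\mathbf{K}}(n)$ is defined to be $0$ if there is no $\mathbf{K}$-configuration into $\mathfrak{C}^n$; $m\ge 1$ if there is a $\mathbf{K}^{*m}$-configuration into $\mathfrak{C}^n$ but no $\mathbf{K}^{*(m+1)}$-configuration into $\mathfrak{C}^n$; and $\infty$ if there is a $\mathbf{K}^{*m}$-configuration into $\mathfrak{C}^n$ for every $m \ge 1$. **Theorem.** For every $n\ge 1$, the ranks $\mathrm{Rk}_{\mathbf{LO}}(n)$,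 $\mathrm{Rk}_{\mathbf{T}}(n)$ and $\mathrm{Rk}_{\mathbf{G}}(n)$ are well defined (exactly one value in $\{0,1,2,\dots,\infty\}$ satisfies the definition), and $$\mathrm{Rk}_{\mathbf{LO}}(n)=n^2-1,\qquad \mathrm{Rk}_{\mathbf{T}}(n)=n^2-1,\qquad \mathrm{Rk}_{\mathbf{G}}(n)=\begin{cases}1 & \text{if } n=1,\\ n^2-1 & \text{if } n\ge 2.\end{cases}$$ -/

import Mathlib

namespace KRank

open FirstOrder FirstOrder.Language FirstOrder.Language.Structure CategoryTheory

/-! ### Index side: classes of finite relational structures -/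

/-- The relation symbol `R` is symmetric on `A`. -/
def RelSymmetric {L₀ : FirstOrder.Language.{0, 0}} {n : ℕ} (R : L₀.Relations n) (A : Type)
    [L₀.Structure A] : Prop :=
  ∀ (a : Fin n → A) (σ : Equiv.Perm (Fin n)), RelMap R a → RelMap R (a ∘ σ)

/-- The relation symbol `R` is trichotomous on `A`. -/
def RelTrichotomous {L₀ : FirstOrder.Language.{0, 0}} {n : ℕ} (R : L₀.Relations n) (A : Type)
    [L₀.Structure A] : Prop :=
  ∀ a : Fin n → A, (∀ i j, i < j → a i ≠ a j) →
    ∃! σ : Equiv.Perm (Fin n), RelMap R (a ∘ σ)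

/-- The relation symbol `R` is irreflexive on `A`. -/
def RelIrreflexive {L₀ : FirstOrder.Language.{0, 0}} {n : ℕ} (R : L₀.Relations n) (A : Type)
    [L₀.Structure A] : Prop :=
  ∀ a : Fin n → A, (∃ i j, i < j ∧ a i = a j) → ¬ RelMap R a

/-- The binary relation symbol `R` is transitive on `A`. -/
def RelTransitive {L₀ : FirstOrder.Language.{0, 0}} (R : L₀.Relations 2) (A : Type)
    [L₀.Structure A] : Prop :=
  ∀ a b c : A, RelMap R ![a, b] → RelMap R ![b, c] → RelMap R ![a, c]

/-- The relation symbols of a language with a single, binary relation symbol. -/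
inductive BinRel : ℕ → Type
  | E : BinRel 2

/-- The language with one binary relation symbol `E` (and nothing else). -/
def binLang : FirstOrder.Language.{0, 0} := ⟨fun _ => Empty, BinRel⟩

instance : binLang.IsRelational := fun _ => inferInstanceAs (IsEmpty Empty)

/-- The relation symbol of `binLang`. -/
def symbE : binLang.Relations 2 := BinRel.E

/-- The class of finite (strict) linear orders. -/
def LO : Set (Bundled.{0} binLang.Structure) :=
  {A | Finite A ∧ RelTrichotomous symbE A ∧ RelIrreflexive symbE A ∧ RelTransitive symbE A}

/-- The class of finite tournaments. -/
def Tour : Set (Bundled.{0} binLang.Structure) :=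
  {A | Finite A ∧ RelTrichotomous symbE A ∧ RelIrreflexive symbE A}

/-- The class of finite graphs. -/
def Gr : Set (Bundled.{0} binLang.Structure) :=
  {A | Finite A ∧ RelSymmetric symbE A ∧ RelIrreflexive symbE A}

/-- The free superposition `K₀ * K₁`: the finite structures in the disjoint union of the two
languages whose reduct to each of the two languages lies in the corresponding class. -/
def freeSuperposition {L₀ L₁ : FirstOrder.Language.{0, 0}} (K₀ : Set (Bundled.{0} L₀.Structure))
    (K₁ : Set (Bundled.{0} L₁.Structure)) : Set (Bundled.{0} (L₀.sum L₁).Structure) :=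
  {A | Finite A ∧
    (⟨A, (LHom.sumInl : L₀ →ᴸ L₀.sum L₁).reduct A⟩ : Bundled.{0} L₀.Structure) ∈ K₀ ∧
    (⟨A, (LHom.sumInr : L₁ →ᴸ L₀.sum L₁).reduct A⟩ : Bundled.{0} L₁.Structure) ∈ K₁}

/-- The language of `K^{*n}`: a disjoint union of `n` copies of `L₀`. -/
def starLang (L₀ : FirstOrder.Language.{0, 0}) : ℕ → FirstOrder.Language.{0, 0}
  | 0 => Language.empty
  | 1 => L₀
  | n + 2 => (starLang L₀ (n + 1)).sum L₀

instance starLang.isRelational (L₀ : FirstOrder.Language.{0, 0}) [L₀.IsRelational] :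
    (n : ℕ) → (starLang L₀ n).IsRelational
  | 0 => inferInstanceAs Language.empty.IsRelational
  | 1 => inferInstanceAs L₀.IsRelational
  | n + 2 =>
    haveI := starLang.isRelational L₀ (n + 1)
    inferInstanceAs ((starLang L₀ (n + 1)).sum L₀).IsRelational

/-- The iterated free superposition: `K^{*1} = K` and `K^{*(n+1)} = K^{*n} * K` for `n ≥ 1`.
By convention (never used below) `K^{*0}` is the class of finite sets. -/
def starPow {L₀ : FirstOrder.Language.{0, 0}} (K : Set (Bundled.{0} L₀.Structure)) :
    (n : ℕ) → Set (Bundled.{0} (starLang L₀ n).Structure)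
  | 0 => {A | Finite A}
  | 1 => K
  | n + 2 => freeSuperposition (starPow K (n + 1)) K

/-! ### Target side: saturated models, types, configurations and ranks -/

section Target

universe u v w

variable {L : FirstOrder.Language.{u, v}} {M : Type w} [L.Structure M]

/-- `M` is `ℵ₁`-saturated: for every countable `A ⊆ M`, every set of `L(A)`-formulas in one
variable that is finitely satisfiable in `M` is realized in `M`. -/
def IsAlephOneSaturated (L : FirstOrder.Language.{u, v}) (M : Type w) [L.Structure M] : Prop :=
  ∀ A : Set M, A.Countable → ∀ p : Set (L[[A]].Formula Unit),
    (∀ q : Set (L[[A]].Formula Unit), q ⊆ p → q.Finite →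
      ∃ b : M, ∀ φ ∈ q, φ.Realize (fun _ => b)) →
    ∃ b : M, ∀ φ ∈ p, φ.Realize (fun _ => b)

/-- The set `π(M)` of realizations in `M` of a set `π` of `L(M)`-formulas in the variables
indexed by `β`. -/
def realizations {β : Type} (π : Set (L[[M]].Formula β)) : Set (β → M) :=
  {b | ∀ φ ∈ π, φ.Realize b}

/-- The function `f : Γ → π(M)` codes every relation of `Γ` by an `L(M)`-formula: for each
`k`-ary relation symbol `R` there is an `L(M)`-formula `φ` in `k` copies of the variables of `π`
such that `Γ ⊨ R(a)` if and only if `M ⊨ φ(f(a))`. -/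
def IsConfiguration {L₀ : FirstOrder.Language.{0, 0}} {β : Type} (π : Set (L[[M]].Formula β))
    {Γ : Type} [L₀.Structure Γ] (f : Γ → β → M) : Prop :=
  (∀ g : Γ, f g ∈ realizations π) ∧
    ∀ (k : ℕ) (R : L₀.Relations k), ∃ φ : L[[M]].Formula (Fin k × β),
      ∀ a : Fin k → Γ, RelMap R a ↔ φ.Realize (fun p => f (a p.1) p.2)

/-- There is a `K`-configuration into `π`, that is, a function from the Fraïssé limit of `K`
to `π(M)` as in `IsConfiguration`. -/
def ExistsConfiguration {L₀ : FirstOrder.Language.{0, 0}} [L₀.IsRelational]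
    (K : Set (Bundled.{0} L₀.Structure)) {β : Type} (π : Set (L[[M]].Formula β)) : Prop :=
  ∃ (Γ : Type) (_ : L₀.Structure Γ) (_ : Countable Γ), IsFraisseLimit K Γ ∧
    ∃ f : Γ → β → M, IsConfiguration (L₀ := L₀) π f

/-- `π` has `K`-rank `r`, where `r ∈ {0, 1, 2, …, ∞}`. -/
def HasRank {L₀ : FirstOrder.Language.{0, 0}} [L₀.IsRelational]
    (K : Set (Bundled.{0} L₀.Structure)) {β : Type} (π : Set (L[[M]].Formula β))
    (r : ℕ∞) : Prop :=
  (r = 0 ∧ ¬ ExistsConfiguration K π) ∨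
  (∃ n : ℕ, 1 ≤ n ∧ r = n ∧
    ExistsConfiguration (starPow K n) π ∧ ¬ ExistsConfiguration (starPow K (n + 1)) π) ∨
  (r = ⊤ ∧ ∀ n : ℕ, 1 ≤ n → ExistsConfiguration (starPow K n) π)

/-- The partial type `y = y` in an `n`-tuple `y` of variables. -/
def trivialType (L : FirstOrder.Language.{u, v}) (M : Type w) (n : ℕ) :
    Set (L[[M]].Formula (Fin n)) :=
  Set.range fun i : Fin n => Term.equal (Term.var i) (Term.var i)

end Target

/-! ### The theory of the random graph -/

/-- The extension axiom: for all `x₀, …, x_{k-1}` and `y₀, …, y_{l-1}` with every `x_i` different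
from every `y_j`, there is `z` adjacent to every `x_i`, and different from and not adjacent to
every `y_j`. -/
noncomputable def extensionAxiom (k l : ℕ) : Language.graph.Sentence :=
  Formula.iAlls (α := Empty) (Fin k ⊕ Fin l) <|
    (Formula.iInf fun p : Fin k × Fin l =>
      ∼(Term.equal (Term.var (Sum.inr (Sum.inl p.1))) (Term.var (Sum.inr (Sum.inr p.2))))).imp <|
    Formula.iExs Unit <|
      (Formula.iInf fun i : Fin k =>
        adj.formula₂ (Term.var (Sum.inr ())) (Term.var (Sum.inl (Sum.inr (Sum.inl i))))) ⊓
      (Formula.iInf fun j : Fin l =>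
        ∼(Term.equal (Term.var (Sum.inr ())) (Term.var (Sum.inl (Sum.inr (Sum.inr j))))) ⊓
        ∼(adj.formula₂ (Term.var (Sum.inr ())) (Term.var (Sum.inl (Sum.inr (Sum.inr j))))))

/-- The theory of the random graph: the axioms of graphs and all extension axioms. -/
def randomGraphTheory : Language.graph.Theory :=
  Theory.simpleGraph ∪ {σ | ∃ k l : ℕ, σ = extensionAxiom k l}

theorem realize_extensionAxiom {M : Type*} [Language.graph.Structure M] (k l : ℕ) :
    M ⊨ extensionAxiom k l ↔ ∀ (x : Fin k → M) (y : Fin l → M), (∀ i j, x i ≠ y j) →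
      ∃ z : M, (∀ i, RelMap adj ![z, x i]) ∧ ∀ j, z ≠ y j ∧ ¬ RelMap adj ![z, y j] := by
  unfold extensionAxiom Sentence.Realize
  rw [Formula.realize_iAlls]
  constructor
  · intro h x y hxy
    have := h (Sum.elim x y)
    simp only [Formula.realize_imp, Formula.realize_iInf, Formula.realize_iExs] at this
    obtain ⟨z, hz⟩ := this (by simpa [Formula.realize_not] using hxy)
    refine ⟨z (), ?_⟩
    simpa [Formula.realize_inf, Formula.realize_iInf, Formula.realize_not,
      Formula.realize_rel₂] using hz
  · intro h v
    simp only [Formula.realize_imp, Formula.realize_iInf, Formula.realize_iExs]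
    intro hv
    obtain ⟨z, hz⟩ := h (fun i => v (Sum.inl i)) (fun j => v (Sum.inr j))
      (by simpa [Formula.realize_not] using hv)
    refine ⟨fun _ => z, ?_⟩
    simpa [Formula.realize_inf, Formula.realize_iInf, Formula.realize_not,
      Formula.realize_rel₂] using hz

end KRank

/-! Each class is `IsBin anti tr` for suitable flags: reversing a pair of distinct points negates
the relation (`anti`) or preserves it, so it acts on the `2 ^ m` types of pairs in `K^{*m}` by
complementation or trivially. Reversing a pair of `n`-tuples transposes its `n × n` adjacency
matrix. The theorem compares these two involutions.

Upper bound. Truth of a formula in the random graph depends only on the quantifier-free type of its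
arguments over finitely many parameters (`exists_finset_parameters`). Partition arguments thin a
configuration to a finite structure in which all pair types still occur, every tuple has the same
type over the parameters, and the equalities between tuples of distinct points follow a fixed
pattern. The adjacency matrix is then the only remaining information (`exists_determined`), so `2 ^
m ≤ 2 ^ (n * n)`. If `m = n * n`, types correspond bijectively to matrices, compatibly with
reversal. For `anti` this is impossible because the zero matrix is symmetric while complementation
has no fixed point; for graphs it is impossible when `n ≥ 2` because some matrix is not symmetric.

Lower bound. Countable graphs embed in every model, so matrices between points of a countable
Fraïssé limit can be prescribed freely, subject to the transposition rule
(`existsConfiguration_of_coding`). In the `anti` case one cell is kept empty so that the orientation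
can be read off, leaving `n * n - 1` cells for relations. For graphs, types are coded by
transposition orbits of matrices, of which there are at least `2 ^ (n * n - 1)`; when `n = 1`
transposition is trivial and both matrices are available. -/

namespace KRank

open FirstOrder FirstOrder.Language FirstOrder.Language.Structure CategoryTheory

/-! ### Classes of binary relations -/

/-- The common form of the three classes: `r` is irreflexive, symmetric or (if `anti` holds)
a tournament, and (if `tr` holds) transitive. -/
structure IsBin (anti tr : Prop) {A : Type*} (r : A → A → Prop) : Prop where
  irrefl : ∀ a, ¬ r a a
  swap : ∀ a b, a ≠ b → (r b a ↔ (r a b ↔ ¬ anti))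
  trans : tr → ∀ a b c, r a b → r b c → r a c

theorem IsBin.comap {anti tr : Prop} {A B : Type*} {r : B → B → Prop} (h : IsBin anti tr r)
    {e : A → B} (he : Function.Injective e) : IsBin anti tr (fun a b => r (e a) (e b)) :=
  ⟨fun _ => h.irrefl _, fun _ _ hab => h.swap _ _ (he.ne hab), fun ht _ _ _ => h.trans ht _ _ _⟩

/-- The lexicographic sum over `I` of relations on `A`. -/
def lexSum {I A : Type*} (r : I → I → Prop) (s : I → A → A → Prop) (x y : I × A) : Prop :=
  (x.1 ≠ y.1 ∧ r x.1 y.1) ∨ (x.1 = y.1 ∧ s x.1 x.2 y.2)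

theorem lexSum_of_ne {I A : Type*} {r : I → I → Prop} {s : I → A → A → Prop} {i j : I} {a b : A}
    (h : i ≠ j) : lexSum r s (i, a) (j, b) ↔ r i j := by
  simp [lexSum, h]

theorem lexSum_of_eq {I A : Type*} {r : I → I → Prop} {s : I → A → A → Prop} {i : I} {a b : A} :
    lexSum r s (i, a) (i, b) ↔ s i a b := by
  simp [lexSum]

theorem IsBin.lexSum {anti tr : Prop} (hta : tr → anti) {I A : Type*} {r : I → I → Prop}
    {s : I → A → A → Prop} (hr : IsBin anti tr r) (hs : ∀ i, IsBin anti tr (s i)) :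
    IsBin anti tr (lexSum r s) where
  irrefl := by
    rintro ⟨i, a⟩
    rw [lexSum_of_eq]
    exact (hs i).irrefl a
  swap := by
    rintro ⟨i, a⟩ ⟨j, b⟩ h
    by_cases hij : i = j
    · subst hij
      rw [lexSum_of_eq, lexSum_of_eq]
      exact (hs i).swap a b (fun hab => h (by rw [hab]))
    · rw [lexSum_of_ne hij, lexSum_of_ne (Ne.symm hij)]
      exact hr.swap i j hij
  trans := by
    rintro ht ⟨i, a⟩ ⟨j, b⟩ ⟨k, c⟩ h₁ h₂
    by_cases hij : i = j
    · subst hij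
      by_cases hik : i = k
      · subst hik
        rw [lexSum_of_eq] at *
        exact (hs i).trans ht _ _ _ h₁ h₂
      · rw [lexSum_of_ne hik] at *
        exact h₂
    · rw [lexSum_of_ne hij] at h₁
      by_cases hjk : j = k
      · subst hjk
        rwa [lexSum_of_ne hij]
      · rw [lexSum_of_ne hjk] at h₂
        -- Passing from `i` to `j` and back contradicts asymmetry; this is why transitivity has to
        -- come with `anti`.
        have hik : i ≠ k := by
          rintro rfl
          have := (hr.swap i j hij).1 h₂
          exact this.1 h₁ (hta ht)
        rw [lexSum_of_ne hik]
        exact hr.trans ht _ _ _ h₁ h₂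

theorem exists_isBin {anti tr : Prop} (hta : tr → anti) (A : Type*) :
    ∃ r : A → A → Prop, IsBin anti tr r := by
  by_cases ha : anti
  · let _ : LinearOrder A := IsWellOrder.linearOrder WellOrderingRel
    refine ⟨(· < ·), fun a => lt_irrefl a, fun a b hab => ?_, fun _ a b c => lt_trans⟩
    simp only [ha, not_true_eq_false, iff_false, not_lt]
    exact ⟨le_of_lt, fun h => lt_of_le_of_ne h (Ne.symm hab)⟩
  · exact ⟨fun _ _ => False, fun _ => id, fun a b _ => by simp [ha], fun ht => absurd (hta ht) ha⟩

theorem exists_isBin_two {anti tr : Prop} (hta : tr → anti) (t : Prop) :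
    ∃ r : Bool → Bool → Prop, IsBin anti tr r ∧ (r false true ↔ t) := by
  refine ⟨fun x y => (x = false ∧ y = true ∧ t) ∨ (x = true ∧ y = false ∧ (t ↔ ¬ anti)),
    ⟨?_, ?_, ?_⟩, by simp⟩
  · rintro (_ | _) <;> simp
  · rintro (_ | _) (_ | _) <;> simp
    tauto
  · rintro ht (_ | _) (_ | _) (_ | _) <;> simp [hta ht]

/-! ### Partition properties -/

/-- The relations `r` on `A` are the pullbacks of the relations `s` along the injective map `e`. -/
structure IsEmb {κ A B : Type*} (r : κ → A → A → Prop) (s : κ → B → B → Prop) (e : A → B) :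
    Prop where
  inj : Function.Injective e
  iff : ∀ k a b, r k a b ↔ s k (e a) (e b)

theorem IsEmb.comp {κ A B D : Type*} {r : κ → A → A → Prop} {s : κ → B → B → Prop}
    {t : κ → D → D → Prop} {e : A → B} {e' : B → D} (h' : IsEmb s t e') (h : IsEmb r s e) :
    IsEmb r t (e' ∘ e) :=
  ⟨h'.inj.comp h.inj, fun k a b => (h.iff k a b).trans (h'.iff k _ _)⟩

theorem isEmb_fiber {κ I A : Type*} {r : κ → I → I → Prop} {s : κ → A → A → Prop} (i : I) :
    IsEmb s (fun k => lexSum (r k) (fun _ => s k)) (fun a => (i, a)) :=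
  ⟨fun a b h => (Prod.mk.inj h).2, fun k a b => by rw [lexSum_of_eq]⟩

theorem isEmb_transversal {κ I A : Type*} {r : κ → I → I → Prop} {s : κ → A → A → Prop}
    (hr : ∀ k i, ¬ r k i i) (hs : ∀ k a, ¬ s k a a) (g : I → A) :
    IsEmb r (fun k => lexSum (r k) (fun _ => s k)) (fun i => (i, g i)) := by
  refine ⟨fun a b h => (Prod.mk.inj h).1, fun k a b => ?_⟩
  by_cases hab : a = b
  · subst hab
    simp [lexSum_of_eq, hr, hs]
  · rw [lexSum_of_ne hab]

/-- The property `P` of families in `X` is unavoidable: for each finite structure `A` of the class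
there is a finite structure `B` of the class such that every family indexed by `B` has property `P`
on a copy of `A` in `B`. -/
def Unavoidable (anti tr : Prop) (κ : Type) (X : Type*)
    (P : ∀ {I : Type}, (I → X) → Prop) : Prop :=
  ∀ (A : Type) (r : κ → A → A → Prop), Finite A → (∀ k, IsBin anti tr (r k)) →
    ∃ (B : Type) (s : κ → B → B → Prop), Finite B ∧ (∀ k, IsBin anti tr (s k)) ∧
      ∀ x : B → X, ∃ e : A → B, IsEmb r s e ∧ P (x ∘ e)

/-- The property `P` of families passes to subfamilies. -/
def IsHereditary {X : Type*} (P : ∀ {I : Type}, (I → X) → Prop) : Prop :=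
  ∀ {I J : Type} (x : J → X) (e : I → J), Function.Injective e → P x → P (x ∘ e)

section

variable {anti tr : Prop} {κ : Type} {X : Type*}

theorem Unavoidable.mono {P Q : ∀ {I : Type}, (I → X) → Prop} (hP : Unavoidable anti tr κ X P)
    (h : ∀ {I : Type} (x : I → X), P x → Q x) : Unavoidable anti tr κ X Q := by
  intro A r hA hr
  obtain ⟨B, s, hB, hs, H⟩ := hP A r hA hr
  refine ⟨B, s, hB, hs, fun x => ?_⟩
  obtain ⟨e, he, hx⟩ := H x
  exact ⟨e, he, h _ hx⟩

/-- A copy of the witness for `Q` is found with property `P`; heredity keeps `P` on the copy of `A`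
chosen inside it. -/
theorem Unavoidable.and {P Q : ∀ {I : Type}, (I → X) → Prop} (hP : Unavoidable anti tr κ X P)
    (hQ : Unavoidable anti tr κ X Q) (hH : IsHereditary P) :
    Unavoidable anti tr κ X (fun x => P x ∧ Q x) := by
  intro A r hA hr
  obtain ⟨B, s, hB, hs, H⟩ := hQ A r hA hr
  obtain ⟨D, t, hD, ht, H'⟩ := hP B s hB hs
  refine ⟨D, t, hD, ht, fun x => ?_⟩
  obtain ⟨e', he', hx'⟩ := H' x
  obtain ⟨e, he, hx⟩ := H (x ∘ e')
  exact ⟨e' ∘ e, he'.comp he, hH (x ∘ e') e he.inj hx', hx⟩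

theorem Unavoidable.trivial : Unavoidable anti tr κ X (fun _ => True) := by
  intro A r hA hr
  exact ⟨A, r, hA, hr, fun x => ⟨id, ⟨Function.injective_id, fun _ _ _ => Iff.rfl⟩, True.intro⟩⟩

theorem Unavoidable.forall_mem {ι : Type*} {P : ι → ∀ {I : Type}, (I → X) → Prop} (S : Finset ι)
    (hP : ∀ i, Unavoidable anti tr κ X (P i)) (hH : ∀ i, IsHereditary (P i)) :
    Unavoidable anti tr κ X (fun x => ∀ i ∈ S, P i x) := by
  classical
  induction S using Finset.induction_on with
  | empty => exact Unavoidable.trivial.mono (by simp)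
  | insert i S _ ih =>
    refine ((hP i).and ih (hH i)).mono fun x hx => ?_
    intro j hj
    rcases Finset.mem_insert.1 hj with rfl | hj
    exacts [hx.1, hx.2 j hj]

theorem Unavoidable.forall {ι : Type*} [Finite ι] {P : ι → ∀ {I : Type}, (I → X) → Prop}
    (hP : ∀ i, Unavoidable anti tr κ X (P i)) (hH : ∀ i, IsHereditary (P i)) :
    Unavoidable anti tr κ X (fun x => ∀ i, P i x) := by
  cases nonempty_fintype ι
  exact (Unavoidable.forall_mem Finset.univ hP hH).mono fun x hx i => hx i (Finset.mem_univ i)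

/-- In the lexicographic square of `A`, either some fibre lies entirely in `q`, or every fibre
contains a point outside `q` and these points form a transversal copy of `A`. -/
theorem unavoidable_iff (hta : tr → anti) (q : X → Prop) :
    Unavoidable anti tr κ X (fun x => ∀ a b, q (x a) ↔ q (x b)) := by
  intro A r hA hr
  refine ⟨A × A, fun k => lexSum (r k) (fun _ => r k), inferInstance,
    fun k => (hr k).lexSum hta (fun _ => hr k), fun x => ?_⟩
  by_cases h : ∃ i, ∀ a, q (x (i, a))
  · obtain ⟨i, hi⟩ := h
    exact ⟨_, isEmb_fiber i, fun a b => by simp [hi]⟩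
  · push Not at h
    choose g hg using h
    exact ⟨_, isEmb_transversal (fun k => (hr k).irrefl) (fun k => (hr k).irrefl) g,
      fun a b => by simp [hg]⟩

/-- Vertex colourings with finitely many colours have monochromatic copies. -/
theorem unavoidable_color (hta : tr → anti) {Y : Type*} [Finite Y] (χ : X → Y) :
    Unavoidable anti tr κ X (fun x => ∀ a b, χ (x a) = χ (x b)) := by
  refine (Unavoidable.forall (P := fun y {I} (x : I → X) => ∀ a b, χ (x a) = y ↔ χ (x b) = y)
    (fun y => unavoidable_iff hta (fun z => χ z = y)) ?_).mono ?_
  · intro y I J x e _ h a b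
    exact h _ _
  · intro I x h a b
    exact ((h (χ (x a)) a b).1 rfl).symm

/-- Take a lexicographic sum of fibres that are Ramsey for `|A|` colours. A fibre with at most `|A|`
values of `u` contains a constant copy of `A`; if there is none, Hall's theorem chooses distinct
values along a transversal. -/
theorem unavoidable_const_or_injective (hta : tr → anti) {Y : Type*} (u : X → Y) :
    Unavoidable anti tr κ X
      (fun x => (∀ a b, u (x a) = u (x b)) ∨ ∀ a b, u (x a) = u (x b) → a = b) := by
  classical
  intro A r hA hr
  cases nonempty_fintype A
  obtain ⟨D, s, hD, hs, H⟩ := unavoidable_color (κ := κ) hta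
    (id : Fin (Fintype.card A) → Fin (Fintype.card A)) A r hA hr
  cases nonempty_fintype D
  refine ⟨A × D, fun k => lexSum (r k) (fun _ => s k), inferInstance,
    fun k => (hr k).lexSum hta (fun _ => hs k), fun x => ?_⟩
  let t : A → Finset Y := fun a => Finset.univ.image fun d => u (x (a, d))
  by_cases h : ∃ a, (t a).card ≤ Fintype.card A
  · obtain ⟨a, ha⟩ := h
    obtain ⟨ι⟩ : Nonempty (t a ↪ Fin (Fintype.card A)) :=
      Function.Embedding.nonempty_of_card_le (by simpa using ha)
    obtain ⟨e, he, hmono⟩ := H fun d =>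
      ι ⟨u (x (a, d)), Finset.mem_image_of_mem _ (Finset.mem_univ _)⟩
    refine ⟨_, (isEmb_fiber a).comp he, Or.inl fun b b' => ?_⟩
    simpa using hmono b b'
  · push Not at h
    have hall : ∀ S : Finset A, S.card ≤ (S.biUnion t).card := by
      intro S
      rcases S.eq_empty_or_nonempty with rfl | ⟨a, ha⟩
      · simp
      · exact (Finset.card_le_univ S).trans ((h a).le.trans
          (Finset.card_le_card (Finset.subset_biUnion_of_mem t ha)))
    obtain ⟨f, hf, hft⟩ := (Finset.all_card_le_biUnion_card_iff_exists_injective t).1 hall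
    have : ∀ a, ∃ d, u (x (a, d)) = f a := fun a => by simpa [t] using hft a
    choose g hg using this
    refine ⟨_, isEmb_transversal (fun k => (hr k).irrefl) (fun k => (hs k).irrefl) g,
      Or.inr fun a b hab => hf ?_⟩
    simpa [hg] using hab

/-- A greedy choice: by injectivity, each point already chosen excludes at most one candidate
through `u` and one through `v`, fewer than `|D|` in all. -/
theorem exists_transversal {A D Y : Type*} [Finite A] [Finite D]
    (hcard : 2 * Nat.card A < Nat.card D) (u v : A × D → Y) (hu : Function.Injective u)
    (hv : Function.Injective v) :
    ∃ g : A → D, ∀ a b, a ≠ b → u (a, g a) ≠ v (b, g b) := by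
  classical
  cases nonempty_fintype A
  cases nonempty_fintype D
  rw [Nat.card_eq_fintype_card, Nat.card_eq_fintype_card] at hcard
  suffices H : ∀ S : Finset A, ∃ g : A → D, ∀ a ∈ S, ∀ b ∈ S, a ≠ b →
      u (a, g a) ≠ v (b, g b) by
    obtain ⟨g, hg⟩ := H Finset.univ
    exact ⟨g, fun a b => hg a (Finset.mem_univ a) b (Finset.mem_univ b)⟩
  intro S
  induction S using Finset.induction_on with
  | empty =>
    have : Nonempty D := Fintype.card_pos_iff.1 (by lia)
    exact ⟨fun _ => Classical.arbitrary D, by simp⟩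
  | insert a S ha ih =>
    obtain ⟨g, hg⟩ := ih
    let Bu : Finset D := Finset.univ.filter fun d => u (a, d) ∈ S.image (fun b => v (b, g b))
    let Bv : Finset D := Finset.univ.filter fun d => v (a, d) ∈ S.image (fun b => u (b, g b))
    have hBu : Bu.card ≤ S.card :=
      (Finset.card_le_card_of_injOn (fun d => u (a, d)) (fun d hd => (Finset.mem_filter.1 hd).2)
        (fun d _ d' _ h => (Prod.mk.inj (hu h)).2)).trans Finset.card_image_le
    have hBv : Bv.card ≤ S.card :=
      (Finset.card_le_card_of_injOn (fun d => v (a, d)) (fun d hd => (Finset.mem_filter.1 hd).2)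
        (fun d _ d' _ h => (Prod.mk.inj (hv h)).2)).trans Finset.card_image_le
    have hlt : (Bu ∪ Bv).card < (Finset.univ : Finset D).card := by
      have h1 := Finset.card_union_le Bu Bv
      have h2 := Finset.card_le_univ S
      rw [Finset.card_univ]
      lia
    obtain ⟨d, -, hd⟩ := Finset.exists_mem_notMem_of_card_lt_card hlt
    have hdu : ∀ b ∈ S, v (b, g b) ≠ u (a, d) := by
      intro b hb hbd
      exact hd (Finset.mem_union_left _ (Finset.mem_filter.2
        ⟨Finset.mem_univ d, Finset.mem_image.2 ⟨b, hb, hbd⟩⟩))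
    have hdv : ∀ b ∈ S, u (b, g b) ≠ v (a, d) := by
      intro b hb hbd
      exact hd (Finset.mem_union_right _ (Finset.mem_filter.2
        ⟨Finset.mem_univ d, Finset.mem_image.2 ⟨b, hb, hbd⟩⟩))
    refine ⟨Function.update g a d, ?_⟩
    intro b hb c hc hbc
    have hS : ∀ b ∈ S, Function.update g a d b = g b := fun b hb =>
      Function.update_of_ne (ne_of_mem_of_not_mem hb ha) _ _
    rcases Finset.mem_insert.1 hb with rfl | hb' <;>
      rcases Finset.mem_insert.1 hc with rfl | hc'
    · exact absurd rfl hbc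
    · rw [Function.update_self, hS c hc']
      exact (hdu c hc').symm
    · rw [Function.update_self, hS b hb']
      exact hdv b hb'
    · rw [hS b hb', hS c hc']
      exact hg b hb' c hc' hbc

/-- The truth value of `u (x a) = v (x b)` does not depend on the distinct indices `a`, `b`. -/
def CrossUniform {Y : Type*} (u v : X → Y) {I : Type} (x : I → X) : Prop :=
  ∀ a b a' b', a ≠ b → a' ≠ b' → (u (x a) = v (x b) ↔ u (x a') = v (x b'))

theorem CrossUniform.isHereditary {Y : Type*} (u v : X → Y) :
    IsHereditary (fun {I} (x : I → X) => CrossUniform u v x) :=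
  fun _ _ he h _ _ _ _ hab hab' => h _ _ _ _ (he.ne hab) (he.ne hab')

/-- Once `u` and `v` are each constant or injective, two constants give a fixed truth value. In the
other cases a transversal makes `u` and `v` disagree at all pairs of distinct points. -/
theorem unavoidable_crossUniform (hta : tr → anti) {Y : Type*} (u v : X → Y) :
    Unavoidable anti tr κ X (fun x => CrossUniform u v x) := by
  have hher : ∀ w : X → Y, IsHereditary (fun {I} (x : I → X) =>
      (∀ a b, w (x a) = w (x b)) ∨ ∀ a b, w (x a) = w (x b) → a = b) := by
    intro w I J x e he h
    exact h.imp (fun h a b => h _ _) (fun h a b hab => he (h _ _ hab))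
  intro A r hA hr
  -- Fibres need more than `2 * |A|` points for the greedy choice, and two points to avoid a single
  -- value.
  choose s hs using fun _ : κ => exists_isBin hta (Fin (2 * Nat.card A + 2))
  obtain ⟨B, t, hB, ht, H⟩ := (unavoidable_const_or_injective hta u).and
    (unavoidable_const_or_injective hta v) (hher u) (A × Fin (2 * Nat.card A + 2))
    (fun k => lexSum (r k) (fun _ => s k)) inferInstance
    (fun k => (hr k).lexSum hta (fun _ => hs k))
  refine ⟨B, t, hB, ht, fun x => ?_⟩
  obtain ⟨e, he, hu, hv⟩ := H x
  suffices hg : ∃ g : A → Fin (2 * Nat.card A + 2),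
      CrossUniform u v fun a => x (e (a, g a)) by
    obtain ⟨g, hg⟩ := hg
    exact ⟨_, he.comp (isEmb_transversal (fun k => (hr k).irrefl) (fun k => (hs k).irrefl) g), hg⟩
  have hne : (0 : Fin (2 * Nat.card A + 2)) ≠ 1 := by simp
  have havoid : ∀ w : X → Y, (∀ p q, w (x (e p)) = w (x (e q)) → p = q) → ∀ c : Y,
      ∃ g : A → Fin (2 * Nat.card A + 2), ∀ a, w (x (e (a, g a))) ≠ c := by
    intro w hw c
    have : ∀ a, ∃ d, w (x (e (a, d))) ≠ c := by
      intro a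
      by_contra! h
      exact hne (Prod.mk.inj (hw (a, 0) (a, 1) ((h 0).trans (h 1).symm))).2
    choose g hg using this
    exact ⟨g, hg⟩
  rcases isEmpty_or_nonempty A with hA' | ⟨⟨a₀⟩⟩
  · exact ⟨fun _ => 0, fun a => isEmptyElim a⟩
  rcases hu with hu | hu <;> rcases hv with hv | hv <;> simp only [Function.comp] at hu hv
  · refine ⟨fun _ => 0, fun a b a' b' _ _ => ?_⟩
    rw [hu (a, 0) (a', 0), hv (b, 0) (b', 0)]
  · obtain ⟨g, hg⟩ := havoid v hv (u (x (e (a₀, 0))))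
    refine ⟨g, fun a b a' b' _ _ => ?_⟩
    rw [hu (a, _) (a₀, 0), hu (a', _) (a₀, 0)]
    exact iff_of_false (hg b).symm (hg b').symm
  · obtain ⟨g, hg⟩ := havoid u hu (v (x (e (a₀, 0))))
    refine ⟨g, fun a b a' b' _ _ => ?_⟩
    rw [hv (b, _) (a₀, 0), hv (b', _) (a₀, 0)]
    exact iff_of_false (hg a) (hg a')
  · obtain ⟨g, hg⟩ := exists_transversal (by simp) (fun p => u (x (e p))) (fun p => v (x (e p)))
      (fun p q h => hu p q h) (fun p q h => hv p q h)
    exact ⟨g, fun a b a' b' hab hab' => iff_of_false (hg a b hab) (hg a' b' hab')⟩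

end

/-- A finite structure of the class in which all types of pairs of distinct points occur. -/
theorem exists_rich {anti tr : Prop} (hta : tr → anti) (κ : Type) [Finite κ] :
    ∃ (A : Type) (r : κ → A → A → Prop), Finite A ∧ (∀ k, IsBin anti tr (r k)) ∧
      ∀ t : κ → Prop, ∃ a b, a ≠ b ∧ ∀ k, r k a b ↔ t k := by
  -- The fibre over each type `t` is a two-point structure realizing `t`; the relations between
  -- fibres are arbitrary.
  choose s hs hst using fun t : Prop => exists_isBin_two hta t
  obtain ⟨r, hr⟩ := exists_isBin hta (κ → Prop)
  refine ⟨(κ → Prop) × Bool, fun k => lexSum r (fun t => s (t k)), inferInstance,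
    fun k => hr.lexSum hta (fun t => hs (t k)), fun t => ⟨(t, false), (t, true), by simp,
      fun k => lexSum_of_eq.trans (hst (t k))⟩⟩

/-! ### A countable generic structure -/

/-- A finite condition: structures of the class on an initial segment of `ℕ`. -/
structure Condition (anti tr : Prop) (κ : Type) where
  /-- the number of points -/
  size : ℕ
  /-- the relations -/
  rel : κ → ℕ → ℕ → Prop
  isBin : ∀ k, IsBin anti tr (fun a b : Set.Iio size => rel k a b)

namespace Condition

variable {anti tr : Prop} {κ : Type}

/-- Values of `rel` beyond the initial segment are irrelevant, so antisymmetry fails. -/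
instance : Preorder (Condition anti tr κ) where
  le p q := p.size ≤ q.size ∧ ∀ k, ∀ a < p.size, ∀ b < p.size, p.rel k a b ↔ q.rel k a b
  le_refl p := ⟨le_rfl, fun _ _ _ _ _ => Iff.rfl⟩
  le_trans p q s h₁ h₂ := ⟨h₁.1.trans h₂.1, fun k a ha b hb =>
    (h₁.2 k a ha b hb).trans (h₂.2 k a (ha.trans_le h₁.1) b (hb.trans_le h₁.1))⟩

instance : Inhabited (Condition anti tr κ) :=
  ⟨⟨0, fun _ _ _ => False, fun _ =>
    ⟨fun a => absurd a.2 (by simp), fun a => absurd a.2 (by simp),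
      fun _ a => absurd a.2 (by simp)⟩⟩⟩

/-- The type `L` of a new point over the finite set `B` is consistent. -/
def Consistent (tr : Prop) (B : Finset ℕ) (r : ℕ → ℕ → Prop) (L : Finset ℕ) : Prop :=
  L ⊆ B ∧ (tr → ∀ a ∈ B, ∀ b ∈ L, r a b → a ∈ L)

/-- The type over `B` must be completed to a type over all existing points. In the transitive case
the new point is put just above the lower set generated by `L k`; consistency ensures that this
lower set meets `B` only in `L k`. -/
theorem exists_extend (hta : tr → anti) (p : Condition anti tr κ) (B : Finset ℕ)
    (hB : ∀ b ∈ B, b < p.size) (L : κ → Finset ℕ) (hL : ∀ k, Consistent tr B (p.rel k) (L k)) :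
    ∃ q : Condition anti tr κ, p ≤ q ∧ q.size = p.size + 1 ∧
      ∀ k, ∀ b ∈ B, q.rel k b p.size ↔ b ∈ L k := by
  classical
  let U : κ → ℕ → Prop := fun k a => a ∈ L k ∨ (tr ∧ ∃ b ∈ L k, p.rel k a b)
  have hUL : ∀ k, ∀ b ∈ B, U k b ↔ b ∈ L k := by
    intro k b hb
    refine ⟨?_, Or.inl⟩
    rintro (h | ⟨ht, c, hc, hbc⟩)
    exacts [h, (hL k).2 ht b hb c hc hbc]
  have hUd : ∀ k, tr → ∀ a < p.size, ∀ b < p.size, U k b → p.rel k a b → U k a := by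
    rintro k ht a ha b hb (h | ⟨-, c, hc, hbc⟩) hab
    · exact Or.inr ⟨ht, b, h, hab⟩
    · exact Or.inr ⟨ht, c, hc,
        (p.isBin k).trans ht ⟨a, ha⟩ ⟨b, hb⟩ ⟨c, hB c ((hL k).1 hc)⟩ hab hbc⟩
  -- The new point is `p.size`; `U` gives the relations into it, and `swap` forces those out of it.
  let R : κ → ℕ → ℕ → Prop := fun k a b =>
    if a = p.size then b ≠ p.size ∧ (U k b ↔ ¬ anti) else if b = p.size then U k a else p.rel k a b
  have R1 : ∀ k, ∀ b < p.size, R k p.size b ↔ (U k b ↔ ¬ anti) := fun k b hb => by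
    simp [R, hb.ne]
  have R2 : ∀ k, ∀ a < p.size, R k a p.size ↔ U k a := fun k a ha => by simp [R, ha.ne]
  have R3 : ∀ k, ∀ a < p.size, ∀ b < p.size, R k a b ↔ p.rel k a b := fun k a ha b hb => by
    simp [R, ha.ne, hb.ne]
  have R4 : ∀ k, ¬ R k p.size p.size := fun k => by simp [R]
  have hcases : ∀ a : Set.Iio (p.size + 1), (a : ℕ) < p.size ∨ (a : ℕ) = p.size := fun a => by
    have := a.2
    simp only [Set.mem_Iio] at this
    lia
  refine ⟨⟨p.size + 1, R, fun k => ⟨?_, ?_, ?_⟩⟩, ⟨Nat.le_succ _, fun k a ha b hb =>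
    (R3 k a ha b hb).symm⟩, rfl, fun k b hb => (R2 k b (hB b hb)).trans (hUL k b hb)⟩
  · intro a
    rcases hcases a with ha | ha
    · rw [R3 k _ ha _ ha]
      exact (p.isBin k).irrefl ⟨a, ha⟩
    · rw [ha]
      exact R4 k
  · intro a b hab
    have hab' : (a : ℕ) ≠ b := fun h => hab (Subtype.ext h)
    rcases hcases a with ha | ha <;> rcases hcases b with hb | hb
    · rw [R3 k _ ha _ hb, R3 k _ hb _ ha]
      exact (p.isBin k).swap ⟨a, ha⟩ ⟨b, hb⟩ (fun h' => hab' (Subtype.mk.inj h'))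
    · rw [hb, R1 k _ ha, R2 k _ ha]
    · rw [ha, R1 k _ hb, R2 k _ hb]
      by_cases hU : U k b <;> by_cases hanti : anti <;> simp [hU, hanti]
    · exact absurd (ha.trans hb.symm) hab'
  · intro ht a b c
    have hanti := hta ht
    have hsw : ∀ x < p.size, ∀ y < p.size, p.rel k x y → ¬ p.rel k y x := by
      intro x hx y hy hxy hyx
      by_cases h : x = y
      · subst h
        exact (p.isBin k).irrefl ⟨x, hx⟩ hxy
      · exact (((p.isBin k).swap ⟨x, hx⟩ ⟨y, hy⟩ (fun h' => h (congrArg Subtype.val h'))).1 hyx).1 hxy hanti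
    have htot : ∀ x < p.size, ∀ y < p.size, U k x → ¬ U k y → p.rel k x y := by
      intro x hx y hy hUx hUy
      by_contra hxy
      have hne : x ≠ y := fun h => hUy (h ▸ hUx)
      refine hUy (hUd k ht y hy x hx hUx ?_)
      exact ((p.isBin k).swap ⟨x, hx⟩ ⟨y, hy⟩ (fun h' => hne (congrArg Subtype.val h'))).2 (by simp [hxy, hanti])
    rcases hcases a with ha | ha <;> rcases hcases b with hb | hb <;> rcases hcases c with hc | hc
    · rw [R3 k _ ha _ hb, R3 k _ hb _ hc, R3 k _ ha _ hc]
      exact (p.isBin k).trans ht ⟨a, ha⟩ ⟨b, hb⟩ ⟨c, hc⟩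
    · rw [hc, R3 k _ ha _ hb, R2 k _ hb, R2 k _ ha]
      exact fun h₁ h₂ => hUd k ht _ ha _ hb h₂ h₁
    · rw [hb, R2 k _ ha, R1 k _ hc, R3 k _ ha _ hc]
      exact fun h₁ h₂ => htot _ ha _ hc h₁ (fun h => h₂.1 h hanti)
    · rw [hb, hc]
      exact fun _ h => absurd h (R4 k)
    · rw [ha, R1 k _ hb, R1 k _ hc, R3 k _ hb _ hc]
      intro h₁ h₂
      have h₃ : ¬ U k c := fun h => h₁.1 (hUd k ht _ hb _ hc h h₂) hanti
      simp [h₃, hanti]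
    · rw [ha, hc, R1 k _ hb, R2 k _ hb]
      exact fun h₁ h₂ => absurd hanti (h₁.1 h₂)
    · rw [ha, hb]
      exact fun h => absurd h (R4 k)
    · rw [ha, hb]
      exact fun h => absurd h (R4 k)

theorem exists_size_le (hta : tr → anti) (p : Condition anti tr κ) (N : ℕ) :
    ∃ q : Condition anti tr κ, p ≤ q ∧ N ≤ q.size := by
  induction N with
  | zero => exact ⟨p, le_rfl, Nat.zero_le _⟩
  | succ N ih =>
    obtain ⟨q, hpq, hq⟩ := ih
    obtain ⟨q', hqq', hq', -⟩ := exists_extend hta q ∅ (by simp) (fun _ => ∅)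
      (fun k => ⟨subset_rfl, by simp⟩)
    exact ⟨q', hpq.trans hqq', by lia⟩

/-- The conditions that decide whether the type `L` over `B` is realized. -/
def deciding (hta : tr → anti) (T : Finset ℕ × (κ → Finset ℕ)) :
    Order.Cofinal (Condition anti tr κ) where
  carrier := {p | (∀ b ∈ T.1, b < p.size) ∧ ((∀ k, Consistent tr T.1 (p.rel k) (T.2 k)) →
    ∃ x < p.size, x ∉ T.1 ∧ ∀ k, ∀ b ∈ T.1, p.rel k b x ↔ b ∈ T.2 k)}
  isCofinal := by
    intro p
    obtain ⟨q, hpq, hq⟩ := exists_size_le hta p (T.1.sup id + 1)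
    have hqB : ∀ b ∈ T.1, b < q.size := fun b hb =>
      lt_of_lt_of_le (Nat.lt_succ_of_le (Finset.le_sup (f := id) hb)) hq
    by_cases hc : ∀ k, Consistent tr T.1 (q.rel k) (T.2 k)
    · obtain ⟨q', hqq', hs, hL⟩ := exists_extend hta q T.1 hqB T.2 hc
      exact ⟨q', ⟨fun b hb => (hqB b hb).trans_le hqq'.1, fun _ =>
        ⟨q.size, by lia, fun h => (hqB _ h).false, hL⟩⟩, hpq.trans hqq'⟩
    · exact ⟨q, ⟨hqB, fun h => absurd h hc⟩, hpq⟩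

end Condition

open Condition in
/-- There is a countable structure of the class that realizes every consistent one-point type over
a finite subset. -/
theorem exists_generic {anti tr : Prop} (hta : tr → anti) (κ : Type) [Finite κ] :
    ∃ R : κ → ℕ → ℕ → Prop, (∀ k, IsBin anti tr (R k)) ∧
      ∀ (B : Finset ℕ) (L : κ → Finset ℕ), (∀ k, Consistent tr B (R k) (L k)) →
        ∃ x ∉ B, ∀ k, ∀ b ∈ B, R k b x ↔ b ∈ L k := by
  classical
  let _ : Encodable (Finset ℕ × (κ → Finset ℕ)) :=
    have : Countable (Finset ℕ × (κ → Finset ℕ)) := inferInstance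
    Encodable.ofCountable _
  let I := Order.idealOfCofinals (default : Condition anti tr κ) (deciding hta)
  have hmeet : ∀ T, ∃ p, p ∈ deciding (anti := anti) hta T ∧ p ∈ I :=
    fun T => Order.cofinal_meets_idealOfCofinals _ _ T
  have hbig : ∀ N, ∃ p ∈ I, N < p.size := by
    intro N
    -- Deciding a type over `{N}` forces the condition to contain the point `N`.
    obtain ⟨p, hp, hpI⟩ := hmeet ({N}, fun _ => ∅)
    exact ⟨p, hpI, hp.1 N (by simp)⟩
  let R : κ → ℕ → ℕ → Prop := fun k a b => ∃ p ∈ I, a < p.size ∧ b < p.size ∧ p.rel k a b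
  have hR : ∀ p ∈ I, ∀ k, ∀ a < p.size, ∀ b < p.size, R k a b ↔ p.rel k a b := by
    intro p hp k a ha b hb
    refine ⟨?_, fun h => ⟨p, hp, ha, hb, h⟩⟩
    rintro ⟨q, hq, ha', hb', h⟩
    obtain ⟨s, -, hps, hqs⟩ := I.directed p hp q hq
    exact (hps.2 k a ha b hb).2 ((hqs.2 k a ha' b hb').1 h)
  refine ⟨R, fun k => ⟨fun a => ?_, fun a b hab => ?_, fun ht a b c => ?_⟩, fun B L hL => ?_⟩
  · obtain ⟨p, hp, ha⟩ := hbig a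
    rw [hR p hp k a ha a ha]
    exact (p.isBin k).irrefl ⟨a, ha⟩
  · obtain ⟨p, hp, h⟩ := hbig (max a b)
    obtain ⟨ha, hb⟩ := max_lt_iff.1 h
    rw [hR p hp k a ha b hb, hR p hp k b hb a ha]
    exact (p.isBin k).swap ⟨a, ha⟩ ⟨b, hb⟩ (fun h' => hab (congrArg Subtype.val h'))
  · obtain ⟨p, hp, h⟩ := hbig (max a (max b c))
    obtain ⟨ha, h⟩ := max_lt_iff.1 h
    obtain ⟨hb, hc⟩ := max_lt_iff.1 h
    rw [hR p hp k a ha b hb, hR p hp k b hb c hc, hR p hp k a ha c hc]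
    exact (p.isBin k).trans ht ⟨a, ha⟩ ⟨b, hb⟩ ⟨c, hc⟩
  · obtain ⟨p, ⟨hpB, hp⟩, hpI⟩ := hmeet (B, L)
    obtain ⟨x, hx, hxB, H⟩ := hp fun k => ⟨(hL k).1, fun ht a ha b hb hab =>
      (hL k).2 ht a ha b hb ((hR p hpI k a (hpB a ha) b (hpB b ((hL k).1 hb))).2 hab)⟩
    exact ⟨x, hxB, fun k b hb => (hR p hpI k b (hpB b hb) x hx).trans (H k b hb)⟩

/-- Finite partial embeddings into a generic structure extend by one point. -/
theorem exists_extend_embedding {anti tr : Prop} {κ : Type} {R : κ → ℕ → ℕ → Prop}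
    (hR : ∀ k, IsBin anti tr (R k))
    (hgen : ∀ (B : Finset ℕ) (L : κ → Finset ℕ), (∀ k, Condition.Consistent tr B (R k) (L k)) →
        ∃ x ∉ B, ∀ k, ∀ b ∈ B, R k b x ↔ b ∈ L k)
    {A : Type*} {r : κ → A → A → Prop} (hr : ∀ k, IsBin anti tr (r k)) (s : Finset A) (e : A → ℕ)
    (hinj : ∀ a ∈ s, ∀ b ∈ s, e a = e b → a = b)
    (he : ∀ k, ∀ a ∈ s, ∀ b ∈ s, R k (e a) (e b) ↔ r k a b) (a : A) (ha : a ∉ s) :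
    ∃ x : ℕ, ∀ b ∈ s, e b ≠ x ∧ ∀ k, (R k (e b) x ↔ r k b a) ∧ (R k x (e b) ↔ r k a b) := by
  classical
  have hcons : ∀ k, Condition.Consistent tr (s.image e) (R k)
      ((s.filter fun b => r k b a).image e) := by
    intro k
    refine ⟨Finset.image_subset_image (Finset.filter_subset _ _), fun ht => ?_⟩
    simp only [Finset.mem_image, Finset.mem_filter]
    rintro _ ⟨b, hb, rfl⟩ _ ⟨c, ⟨hc, hca⟩, rfl⟩ hbc
    exact ⟨b, ⟨hb, (hr k).trans ht b c a ((he k b hb c hc).1 hbc) hca⟩, rfl⟩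
  obtain ⟨x, hxB, hx⟩ := hgen _ _ hcons
  have hne : ∀ b ∈ s, e b ≠ x := fun b hb h => hxB (h ▸ Finset.mem_image_of_mem e hb)
  have hx' : ∀ k, ∀ b ∈ s, R k (e b) x ↔ r k b a := by
    intro k b hb
    rw [hx k _ (Finset.mem_image_of_mem e hb), Finset.mem_image]
    constructor
    · rintro ⟨c, hc, hcb⟩
      rw [Finset.mem_filter] at hc
      rw [← hinj c hc.1 b hb hcb]
      exact hc.2
    · exact fun h => ⟨b, Finset.mem_filter.2 ⟨hb, h⟩, rfl⟩
  refine ⟨x, fun b hb => ⟨hne b hb, fun k => ⟨hx' k b hb, ?_⟩⟩⟩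
  rw [(hR k).swap _ _ (hne b hb), (hr k).swap b a (fun h => ha (h ▸ hb)), hx' k b hb]

/-! ### Binary relational languages -/

section BinaryLanguage

universe u v

variable {L : FirstOrder.Language.{u, v}} {κ : Type*}

/-- Every relation symbol of `L` is one of the binary symbols `sym i`. -/
def Exhausts (sym : κ → L.Relations 2) : Prop :=
  ∀ P : ∀ k, L.Relations k → Prop, (∀ i, P 2 (sym i)) → ∀ k R, P k R

theorem Exhausts.isEmpty_relations_zero {sym : κ → L.Relations 2} (hsym : Exhausts sym) :
    IsEmpty (L.Relations 0) :=
  ⟨fun R => absurd (hsym (fun k _ => k = 2) (fun _ => rfl) 0 R) (by decide)⟩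

theorem Embedding.relMap_pair {A B : Type*} [L.Structure A] [L.Structure B] (f : A ↪[L] B)
    (R : L.Relations 2) (a b : A) : RelMap R ![f a, f b] ↔ RelMap R ![a, b] := by
  rw [← f.map_rel R (![a, b])]
  have : f ∘ ![a, b] = ![f a, f b] := by
    funext j
    fin_cases j <;> rfl
  rw [this]

variable [L.IsRelational]

/-- An embedding of structures from an injective map that preserves the binary relations. -/
def mkEmbedding {sym : κ → L.Relations 2} (hsym : Exhausts sym) {A B : Type*} [L.Structure A]
    [L.Structure B] (e : A → B) (he : Function.Injective e)
    (h : ∀ i a b, RelMap (sym i) ![e a, e b] ↔ RelMap (sym i) ![a, b]) : A ↪[L] B where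
  toFun := e
  inj' := he
  map_fun' f := isEmptyElim f
  map_rel' {k} R := by
    refine hsym (fun k R => ∀ x : Fin k → A, RelMap R (e ∘ x) ↔ RelMap R x) (fun i x => ?_) k R
    have h1 : e ∘ x = ![e (x 0), e (x 1)] := by
      funext j
      fin_cases j <;> rfl
    have h2 : x = ![x 0, x 1] := by
      funext j
      fin_cases j <;> rfl
    rw [h1, h, ← h2]

/-- In a relational language, adjoining `m` to a substructure adds only the point `m`. Binary
symbols require matching only the pairs of `m` with old points, since irreflexivity settles the pair
of `m` with itself. -/
theorem isExtensionPair_of_exists {sym : κ → L.Relations 2} (hsym : Exhausts sym) {A B : Type*}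
    [L.Structure A] [L.Structure B] [Nonempty B]
    (hA : ∀ i (a : A), ¬ RelMap (sym i) ![a, a]) (hB : ∀ i (b : B), ¬ RelMap (sym i) ![b, b])
    (H : ∀ (s : Finset A) (e : A → B), (∀ a ∈ s, ∀ b ∈ s, e a = e b → a = b) →
      (∀ i, ∀ a ∈ s, ∀ b ∈ s, RelMap (sym i) ![e a, e b] ↔ RelMap (sym i) ![a, b]) → ∀ a ∉ s,
      ∃ x, ∀ b ∈ s, e b ≠ x ∧ ∀ i, (RelMap (sym i) ![e b, x] ↔ RelMap (sym i) ![b, a]) ∧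
        (RelMap (sym i) ![x, e b] ↔ RelMap (sym i) ![a, b])) :
    L.IsExtensionPair A B := by
  classical
  rw [isExtensionPair_iff_exists_embedding_closure_singleton_sup]
  intro S hS f m
  by_cases hm : m ∈ S
  · have hle : Substructure.closure L {m} ⊔ S ≤ S :=
      sup_le (by simpa [Substructure.closure_le] using hm) le_rfl
    exact ⟨f.comp (Substructure.inclusion hle), by ext x; rfl⟩
  have hmem : ∀ x : (Substructure.closure L {m} ⊔ S : L.Substructure A),
      (x : A) = m ∨ (x : A) ∈ S := by
    rintro ⟨x, hx⟩
    rw [← Substructure.closure_eq S, ← Substructure.closure_union,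
      Substructure.mem_closure_iff_of_isRelational] at hx
    simpa using hx
  have hfin : Set.Finite (S : Set A) := (S.fg_iff_structure_fg.1 hS).finite
  -- The default value outside `S` plays no role.
  let e : A → B := fun a => if h : a ∈ S then f ⟨a, h⟩ else Classical.arbitrary B
  have heS : ∀ a (h : a ∈ S), e a = f ⟨a, h⟩ := fun a h => dif_pos h
  obtain ⟨y, hy⟩ := H hfin.toFinset e
    (by
      intro a ha b hb hab
      have ha : a ∈ S := by simpa using ha
      have hb : b ∈ S := by simpa using hb
      rw [heS a ha, heS b hb] at hab
      exact congrArg Subtype.val (f.injective hab))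
    (by
      intro i a ha b hb
      have ha : a ∈ S := by simpa using ha
      have hb : b ∈ S := by simpa using hb
      rw [heS a ha, heS b hb, Embedding.relMap_pair]
      exact (Embedding.relMap_pair S.subtype (sym i) ⟨a, ha⟩ ⟨b, hb⟩).symm)
    m (by simpa using hm)
  have hy' : ∀ b ∈ S, e b ≠ y ∧ ∀ i, (RelMap (sym i) ![e b, y] ↔ RelMap (sym i) ![b, m]) ∧
      (RelMap (sym i) ![y, e b] ↔ RelMap (sym i) ![m, b]) := fun b hb => hy b (by simpa using hb)
  let g : (Substructure.closure L {m} ⊔ S : L.Substructure A) → B :=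
    fun x => if (x : A) = m then y else e x
  have hgm : ∀ x : (Substructure.closure L {m} ⊔ S : L.Substructure A), (x : A) = m → g x = y :=
    fun x h => if_pos h
  have hgS : ∀ x : (Substructure.closure L {m} ⊔ S : L.Substructure A), (x : A) ∈ S → g x = e x :=
    fun x h => if_neg (ne_of_mem_of_not_mem h hm)
  have hpair : ∀ i (a b : (Substructure.closure L {m} ⊔ S : L.Substructure A)),
      RelMap (sym i) ![a, b] ↔ RelMap (sym i) ![(a : A), (b : A)] := fun i a b =>
    (Embedding.relMap_pair (Substructure.subtype _) (sym i) a b).symm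
  refine ⟨mkEmbedding hsym g ?_ ?_, ?_⟩
  · intro a b hab
    apply Subtype.ext
    rcases hmem a with ha | ha <;> rcases hmem b with hb | hb
    · rw [ha, hb]
    · rw [hgm a ha, hgS b hb] at hab
      exact absurd hab.symm (hy' b hb).1
    · rw [hgS a ha, hgm b hb] at hab
      exact absurd hab (hy' a ha).1
    · rw [hgS a ha, hgS b hb, heS a ha, heS b hb] at hab
      simpa using f.injective hab
  · intro i a b
    rw [hpair]
    rcases hmem a with ha | ha <;> rcases hmem b with hb | hb
    · rw [hgm a ha, hgm b hb, ha, hb]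
      exact iff_of_false (hB i y) (hA i m)
    · rw [hgm a ha, hgS b hb, ha]
      exact ((hy' b hb).2 i).2
    · rw [hgS a ha, hgm b hb, hb]
      exact ((hy' a ha).2 i).1
    · rw [hgS a ha, hgS b hb, heS a ha, heS b hb, Embedding.relMap_pair]
      exact (Embedding.relMap_pair S.subtype (sym i) ⟨a, ha⟩ ⟨b, hb⟩).symm
  · ext x
    have : g (Substructure.inclusion le_sup_right x) = e x := hgS _ x.2
    change f x = g (Substructure.inclusion le_sup_right x)
    rw [this, heS x x.2]

/-- The forth construction starts from the empty partial map, which is available since there are no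
nullary symbols. -/
theorem nonempty_embedding_of_isExtensionPair {sym : κ → L.Relations 2} (hsym : Exhausts sym)
    {A B : Type*} [L.Structure A] [L.Structure B] [Countable A] (h : L.IsExtensionPair A B) :
    Nonempty (A ↪[L] B) := by
  have := hsym.isEmpty_relations_zero
  obtain ⟨f, -⟩ := embedding_from_cg cg_of_countable (default : L.FGEquiv A B) h
  exact ⟨f⟩

end BinaryLanguage

/-! ### The languages of iterated superpositions -/

/-- The relation symbols of the language of `K^{*m}`. -/
def starSym : (m : ℕ) → Fin m → (starLang binLang m).Relations 2
  | 0 => fun i => i.elim0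
  | 1 => fun _ => symbE
  | m + 2 => Fin.lastCases (Sum.inr symbE) (fun i => Sum.inl (starSym (m + 1) i))

theorem starSym_castSucc (m : ℕ) (i : Fin (m + 1)) :
    starSym (m + 2) i.castSucc = (Sum.inl (starSym (m + 1) i) :
      ((starLang binLang (m + 1)).sum binLang).Relations 2) :=
  Fin.lastCases_castSucc (motive := fun _ => ((starLang binLang (m + 1)).sum binLang).Relations 2)
    (last := Sum.inr symbE) (cast := fun i => Sum.inl (starSym (m + 1) i)) i

theorem starSym_last (m : ℕ) :
    starSym (m + 2) (Fin.last (m + 1)) = (Sum.inr symbE :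
      ((starLang binLang (m + 1)).sum binLang).Relations 2) :=
  Fin.lastCases_last (motive := fun _ => ((starLang binLang (m + 1)).sum binLang).Relations 2)
    (last := Sum.inr symbE) (cast := fun i => Sum.inl (starSym (m + 1) i))

theorem exhausts_starSym : ∀ m : ℕ, Exhausts (starSym m)
  | 0 => fun _ _ _ R => Empty.elim R
  | 1 => fun P h k R => by
    cases R
    exact h 0
  | m + 2 => fun P h k R => by
    rcases R with R | R
    · refine exhausts_starSym (m + 1) (fun k R => P k (Sum.inl R)) (fun i => ?_) k R
      have := h i.castSucc
      rwa [starSym_castSucc] at this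
    · cases R
      have := h (Fin.last (m + 1))
      rwa [starSym_last] at this

theorem exists_structure {A : Type} : ∀ (m : ℕ) (r : Fin m → A → A → Prop),
    ∃ S : (starLang binLang m).Structure A, ∀ i a b, S.RelMap (starSym m i) ![a, b] ↔ r i a b
  | 0, _ => ⟨⟨fun f => Empty.elim f, fun R => Empty.elim R⟩, fun i => i.elim0⟩
  | 1, r => ⟨⟨fun f => Empty.elim f, fun R => match R with
      | BinRel.E => fun x => r 0 (x 0) (x 1)⟩, fun i a b => by
      rw [Subsingleton.elim i 0]
      rfl⟩
  | m + 2, r => by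
    obtain ⟨S, hS⟩ := exists_structure (m + 1) (fun i => r i.castSucc)
    let S' : binLang.Structure A := ⟨fun f => Empty.elim f, fun R => match R with
      | BinRel.E => fun x => r (Fin.last (m + 1)) (x 0) (x 1)⟩
    refine ⟨Language.sumStructure (starLang binLang (m + 1)) binLang A, fun i a b => ?_⟩
    induction i using Fin.lastCases with
    | last => rw [starSym_last]; rfl
    | cast i => rw [starSym_castSucc]; exact hS i a b

/-- `K` is the class of finite structures whose relation satisfies `IsBin anti tr`. -/
def IsBinClass (anti tr : Prop) (K : Set (Bundled.{0} binLang.Structure)) : Prop :=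
  ∀ A : Bundled.{0} binLang.Structure, A ∈ K ↔
    Finite A ∧ IsBin anti tr (fun a b : A => RelMap symbE ![a, b])

theorem mem_starPow {anti tr : Prop} {K : Set (Bundled.{0} binLang.Structure)}
    (hK : IsBinClass anti tr K) : ∀ (m : ℕ) (A : Bundled.{0} (starLang binLang m).Structure),
    A ∈ starPow K m ↔
      Finite A ∧ ∀ i, IsBin anti tr (fun a b : A => RelMap (starSym m i) ![a, b])
  | 0, A => ⟨fun h => ⟨h, fun i => i.elim0⟩, fun h => h.1⟩
  | 1, A => (hK A).trans (and_congr_right fun _ => ⟨fun h _ => h, fun h => h 0⟩)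
  | m + 2, A => by
    let _ : ((starLang binLang (m + 1)).sum binLang).Structure A := A.str
    have h1 := mem_starPow hK (m + 1)
      ⟨A, (LHom.sumInl : starLang binLang (m + 1) →ᴸ (starLang binLang (m + 1)).sum binLang).reduct A⟩
    have h2 := hK
      ⟨A, (LHom.sumInr : binLang →ᴸ (starLang binLang (m + 1)).sum binLang).reduct A⟩
    refine (and_congr_right fun hA => and_congr h1 h2).trans ?_
    refine and_congr_right fun hA => ?_
    refine ((and_congr (and_iff_right hA) (and_iff_right hA))).trans ?_
    constructor
    · rintro ⟨h, h'⟩ i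
      induction i using Fin.lastCases with
      | last => rw [starSym_last]; exact h'
      | cast i => rw [starSym_castSucc]; exact h i
    · intro h
      refine ⟨fun i => ?_, ?_⟩
      · have := h i.castSucc
        rw [starSym_castSucc] at this
        exact this
      · have := h (Fin.last (m + 1))
        rw [starSym_last] at this
        exact this

/-! ### The three classes as instances of `IsBin` -/

theorem relSymmetric_iff {A : Type} [binLang.Structure A] :
    RelSymmetric symbE A ↔ ∀ a b : A, RelMap symbE ![a, b] → RelMap symbE ![b, a] := by
  constructor
  · intro h a b hab
    have := h ![a, b] (Equiv.swap 0 1) hab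
    convert this using 1
    funext j
    fin_cases j <;> rfl
  · intro h a σ ha
    have ha' : a = ![a 0, a 1] := by
      funext j
      fin_cases j <;> rfl
    have hσ : a ∘ σ = ![a (σ 0), a (σ 1)] := by
      funext j
      fin_cases j <;> rfl
    rw [ha'] at ha
    rw [hσ]
    rcases Fin.exists_fin_two.1 ⟨σ 0, rfl⟩ with h0 | h0 <;>
      rcases Fin.exists_fin_two.1 ⟨σ 1, rfl⟩ with h1 | h1
    · exact absurd (σ.injective (h0.trans h1.symm)) (by decide)
    · rwa [h0, h1]
    · rw [h0, h1]
      exact h _ _ ha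
    · exact absurd (σ.injective (h0.trans h1.symm)) (by decide)

theorem relIrreflexive_iff {A : Type} [binLang.Structure A] :
    RelIrreflexive symbE A ↔ ∀ a : A, ¬ RelMap symbE ![a, a] := by
  constructor
  · exact fun h a => h ![a, a] ⟨0, 1, by decide, rfl⟩
  · rintro h a ⟨i, j, hij, haij⟩
    have hi : i = 0 := by lia
    have hj : j = 1 := by lia
    subst hi hj
    have ha' : a = ![a 0, a 0] := by
      funext j
      fin_cases j
      · rfl
      · exact haij.symm
    rw [ha']
    exact h _

theorem perm_fin_two (σ : Equiv.Perm (Fin 2)) : σ = 1 ∨ σ = Equiv.swap 0 1 := by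
  revert σ
  decide

theorem relTrichotomous_iff {A : Type} [binLang.Structure A] :
    RelTrichotomous symbE A ↔
      ∀ a b : A, a ≠ b → (RelMap symbE ![b, a] ↔ ¬ RelMap symbE ![a, b]) := by
  have key : ∀ x : Fin 2 → A, (∃! σ : Equiv.Perm (Fin 2), RelMap symbE (x ∘ σ)) ↔
      (RelMap symbE ![x 1, x 0] ↔ ¬ RelMap symbE ![x 0, x 1]) := by
    intro x
    have h1 : x ∘ (1 : Equiv.Perm (Fin 2)) = ![x 0, x 1] := by
      funext j
      fin_cases j <;> rfl
    have h2 : x ∘ (Equiv.swap 0 1 : Equiv.Perm (Fin 2)) = ![x 1, x 0] := by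
      funext j
      fin_cases j <;> rfl
    have hne : (1 : Equiv.Perm (Fin 2)) ≠ Equiv.swap 0 1 := by decide
    constructor
    · rintro ⟨σ, hσ, huniq⟩
      constructor
      · intro h h'
        exact hne ((huniq 1 (by simpa only [h1] using h')).trans
          (huniq (Equiv.swap 0 1) (by simpa only [h2] using h)).symm)
      · intro h
        rcases perm_fin_two σ with rfl | rfl
        · exact absurd (by simpa only [h1] using hσ) h
        · simpa only [h2] using hσ
    · intro h
      by_cases h' : RelMap symbE ![x 0, x 1]
      · refine ⟨1, by simpa only [h1] using h', fun σ hσ => ?_⟩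
        rcases perm_fin_two σ with rfl | rfl
        · rfl
        · exact absurd h' (h.1 (by simpa only [h2] using hσ))
      · refine ⟨Equiv.swap 0 1, by simpa only [h2] using h.2 h', fun σ hσ => ?_⟩
        rcases perm_fin_two σ with rfl | rfl
        · exact absurd (by simpa only [h1] using hσ) h'
        · rfl
  constructor
  · intro h a b hab
    refine (key ![a, b]).1 (h ![a, b] ?_)
    intro i j hij
    have hi : i = 0 := by lia
    have hj : j = 1 := by lia
    subst hi hj
    exact hab
  · intro h x hx
    exact (key x).2 (h _ _ (hx 0 1 (by decide)))

theorem isBinClass_LO : IsBinClass True True LO := by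
  intro A
  refine and_congr_right fun _ => ?_
  rw [relTrichotomous_iff, relIrreflexive_iff]
  constructor
  · rintro ⟨h1, h2, h3⟩
    exact ⟨h2, fun a b hab => by simpa using h1 a b hab, fun _ => h3⟩
  · rintro ⟨h1, h2, h3⟩
    exact ⟨fun a b hab => by simpa using h2 a b hab, h1, h3 True.intro⟩

theorem isBinClass_Tour : IsBinClass True False Tour := by
  intro A
  refine and_congr_right fun _ => ?_
  rw [relTrichotomous_iff, relIrreflexive_iff]
  constructor
  · rintro ⟨h1, h2⟩
    exact ⟨h2, fun a b hab => by simpa using h1 a b hab, False.elim⟩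
  · rintro ⟨h1, h2, h3⟩
    exact ⟨fun a b hab => by simpa using h2 a b hab, h1⟩

theorem isBinClass_Gr : IsBinClass False False Gr := by
  intro A
  refine and_congr_right fun _ => ?_
  rw [relSymmetric_iff, relIrreflexive_iff]
  constructor
  · rintro ⟨h1, h2⟩
    exact ⟨h2, fun a b hab => by simpa using ⟨h1 b a, h1 a b⟩, False.elim⟩
  · rintro ⟨h1, h2, h3⟩
    refine ⟨fun a b h => ?_, h1⟩
    by_cases hab : a = b
    · rwa [← hab] at h ⊢
    · exact (h2 a b hab).2 (by simpa using h)

/-- The Fraïssé limit of `K^{*m}`. -/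
theorem exists_fraisseLimit {anti tr : Prop} (hta : tr → anti)
    {K : Set (Bundled.{0} binLang.Structure)} (hK : IsBinClass anti tr K) (m : ℕ) :
    ∃ S : (starLang binLang m).Structure ℕ, IsFraisseLimit (starPow K m) ℕ ∧
      ∀ i, IsBin anti tr (fun a b => S.RelMap (starSym m i) ![a, b]) := by
  obtain ⟨R, hR, hgen⟩ := exists_generic hta (Fin m)
  obtain ⟨S, hS⟩ := exists_structure m R
  have hRS : ∀ i, (fun a b => S.RelMap (starSym m i) ![a, b]) = R i := fun i => by
    funext a b
    exact propext (hS i a b)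
  have hbin : ∀ i, IsBin anti tr (fun a b => S.RelMap (starSym m i) ![a, b]) := fun i =>
    hRS i ▸ hR i
  -- Taking `A = ℕ` gives ultrahomogeneity; taking `A` finite shows that the age is the whole class.
  have hext : ∀ (A : Type) [(starLang binLang m).Structure A],
      (∀ i, IsBin anti tr (fun a b : A => RelMap (starSym m i) ![a, b])) →
      (starLang binLang m).IsExtensionPair A ℕ := by
    intro A _ hA
    refine isExtensionPair_of_exists (exhausts_starSym m) (fun i => (hA i).irrefl)
      (fun i => (hbin i).irrefl) fun s e hinj he a ha => ?_
    have := exists_extend_embedding hR hgen hA s e hinj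
      (fun k a ha b hb => (hS k _ _).symm.trans (he k a ha b hb)) a ha
    simpa only [← hS] using this
  refine ⟨S, ⟨(isUltrahomogeneous_iff_IsExtensionPair cg_of_countable).2 (hext ℕ hbin), ?_⟩, hbin⟩
  ext A
  rw [mem_starPow hK]
  constructor
  · rintro ⟨hfg, ⟨f⟩⟩
    refine ⟨hfg.finite, fun i => ?_⟩
    have := (hbin i).comap f.injective
    refine (congrArg (IsBin anti tr) ?_).mp this
    funext a b
    exact propext (Embedding.relMap_pair f _ a b)
  · rintro ⟨hfin, hA⟩
    exact ⟨Structure.fg_iff_finite.2 hfin,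
      nonempty_embedding_of_isExtensionPair (exhausts_starSym m) (hext A hA)⟩

/-! ### Models of the theory of the random graph -/

section RandomGraph

variable {M : Type*} [Language.graph.Structure M]

theorem adj_irrefl (hM : M ⊨ randomGraphTheory) (x : M) : ¬ RelMap adj ![x, x] := by
  have h : M ⊨ Theory.simpleGraph := hM.mono Set.subset_union_left
  exact (Theory.simpleGraph_model_iff.1 h).1.irrefl x

theorem adj_comm (hM : M ⊨ randomGraphTheory) (x y : M) :
    RelMap adj ![x, y] ↔ RelMap adj ![y, x] := by
  have h : M ⊨ Theory.simpleGraph := hM.mono Set.subset_union_left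
  exact ⟨fun h' => (Theory.simpleGraph_model_iff.1 h).2.symm x y h',
    fun h' => (Theory.simpleGraph_model_iff.1 h).2.symm y x h'⟩

/-- The axiom separates `z` only from its non-neighbours; it differs from its neighbours in `X`
because adjacency is irreflexive. -/
theorem exists_adj_iff (hM : M ⊨ randomGraphTheory) (X : Finset M) (Q : M → Prop) :
    ∃ z ∉ X, ∀ x ∈ X, RelMap adj ![z, x] ↔ Q x := by
  classical
  let Y := X.filter Q
  let N := X.filter fun x => ¬ Q x
  have hax : M ⊨ extensionAxiom Y.card N.card :=
    hM.realize_of_mem _ (Or.inr ⟨_, _, rfl⟩)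
  obtain ⟨z, hzY, hzN⟩ := (realize_extensionAxiom _ _).1 hax (fun i => (Y.equivFin.symm i : M))
    (fun j => (N.equivFin.symm j : M)) (fun i j h => by
      have h1 := (Finset.mem_filter.1 (Y.equivFin.symm i).2).2
      have h2 := (Finset.mem_filter.1 (N.equivFin.symm j).2).2
      rw [h] at h1
      exact h2 h1)
  have hY : ∀ x ∈ X, Q x → RelMap adj ![z, x] := fun x hx hq => by
    simpa using hzY (Y.equivFin ⟨x, Finset.mem_filter.2 ⟨hx, hq⟩⟩)
  have hN : ∀ x ∈ X, ¬ Q x → z ≠ x ∧ ¬ RelMap adj ![z, x] := fun x hx hq => by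
    simpa using hzN (N.equivFin ⟨x, Finset.mem_filter.2 ⟨hx, hq⟩⟩)
  refine ⟨z, fun hz => ?_, fun x hx => ⟨fun h => ?_, hY x hx⟩⟩
  · by_cases hq : Q z
    · exact adj_irrefl hM z (hY z hz hq)
    · exact (hN z hz hq).1 rfl
  · by_contra hq
    exact (hN x hx hq).2 h

theorem exhausts_adj : Exhausts (fun _ : Unit => (adj : Language.graph.Relations 2)) := by
  intro P h k R
  cases R
  exact h ()

/-- Countable graphs embed into models of the theory of the random graph. -/
theorem exists_graph_embedding (hM : M ⊨ randomGraphTheory) {V : Type*} [Countable V]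
    (G : SimpleGraph V) :
    ∃ f : V → M, Function.Injective f ∧ ∀ a b, RelMap adj ![f a, f b] ↔ G.Adj a b := by
  classical
  let _ : Language.graph.Structure V := G.structure
  have hG : ∀ a b : V, RelMap adj ![a, b] ↔ G.Adj a b := fun a b => Iff.rfl
  obtain ⟨z, -⟩ := exists_adj_iff hM ∅ (fun _ => True)
  have : Nonempty M := ⟨z⟩
  have hext : Language.graph.IsExtensionPair V M := by
    refine isExtensionPair_of_exists exhausts_adj (fun _ a => ?_) (fun _ b => adj_irrefl hM b) ?_
    · rw [hG]
      exact G.loopless.irrefl a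
    · intro s e hinj he a ha
      obtain ⟨x, hx, H⟩ := exists_adj_iff hM (s.image e) (fun y => ∃ b ∈ s, e b = y ∧ G.Adj a b)
      have hx' : ∀ b ∈ s, RelMap adj ![x, e b] ↔ G.Adj a b := by
        intro b hb
        rw [H _ (Finset.mem_image_of_mem e hb)]
        constructor
        · rintro ⟨c, hc, hcb, hac⟩
          rwa [← hinj c hc b hb hcb]
        · exact fun h => ⟨b, hb, rfl, h⟩
      refine ⟨x, fun b hb => ⟨fun h => hx (h ▸ Finset.mem_image_of_mem e hb), fun _ => ⟨?_, ?_⟩⟩⟩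
      · rw [adj_comm hM, hx' b hb, hG, G.adj_comm]
      · rw [hx' b hb, hG]
  obtain ⟨f⟩ := nonempty_embedding_of_isExtensionPair exhausts_adj hext
  exact ⟨f, f.injective, fun a b => (Embedding.relMap_pair f adj a b).trans (hG a b)⟩

/-- The tuples `u` and `w` have the same quantifier-free type on the index set `D`. -/
def SamePattern {I : Type*} (D : Set I) (u w : I → M) : Prop :=
  ∀ p ∈ D, ∀ q ∈ D, (u p = u q ↔ w p = w q) ∧
    (RelMap adj ![u p, u q] ↔ RelMap adj ![w p, w q])

/-- One step of back and forth: an `x` among the values of `u` is matched by the corresponding value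
of `w`, and any other `x` by an extension axiom. -/
theorem SamePattern.exists_extend (hM : M ⊨ randomGraphTheory) {I : Type*} {D : Set I}
    (hD : D.Finite) {u w : I → M} (h : SamePattern D u w) (x : M) :
    ∃ y, ∀ p ∈ D, (u p = x ↔ w p = y) ∧ (RelMap adj ![u p, x] ↔ RelMap adj ![w p, y]) := by
  classical
  by_cases hx : ∃ q ∈ D, u q = x
  · obtain ⟨q, hq, rfl⟩ := hx
    exact ⟨w q, fun p hp => h p hp q hq⟩
  · push Not at hx
    obtain ⟨y, hy, H⟩ := exists_adj_iff hM (hD.toFinset.image w)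
      (fun z => ∃ p ∈ D, w p = z ∧ RelMap adj ![u p, x])
    have hmem : ∀ p ∈ D, w p ∈ hD.toFinset.image w := fun p hp =>
      Finset.mem_image_of_mem w (by simpa using hp)
    refine ⟨y, fun p hp => ⟨iff_of_false (hx p hp) (fun h => hy (h ▸ hmem p hp)), ?_⟩⟩
    rw [adj_comm hM (w p), H _ (hmem p hp)]
    constructor
    · exact fun h => ⟨p, hp, rfl, h⟩
    · rintro ⟨q, hq, hqp, hqx⟩
      rwa [← ((h q hq p hp).1.2 hqp)]

theorem SamePattern.mono {I : Type*} {D D' : Set I} (hD : D ⊆ D') {u w : I → M}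
    (h : SamePattern D' u w) : SamePattern D u w :=
  fun p hp q hq => h p (hD hp) q (hD hq)

/-- The variables of a bounded formula that a finite set of free variables allows. -/
def allowed {γ : Type*} (F : Finset γ) (k : ℕ) : Set (γ ⊕ Fin k) :=
  {p | ∀ c, p = Sum.inl c → c ∈ F}

theorem allowed_finite {γ : Type*} (F : Finset γ) (k : ℕ) : (allowed F k).Finite := by
  refine ((F.finite_toSet.image Sum.inl).union (Set.finite_range Sum.inr)).subset ?_
  rintro (c | j) h
  · exact Or.inl ⟨c, h c rfl, rfl⟩
  · exact Or.inr ⟨j, rfl⟩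

theorem allowed_mono {γ : Type*} {F F' : Finset γ} (h : F ⊆ F') (k : ℕ) :
    allowed F k ⊆ allowed F' k :=
  fun _ hp c hc => h (hp c hc)

theorem exists_term_var {γ : Type*} {k : ℕ} (t : Language.graph.Term (γ ⊕ Fin k)) :
    ∃ p, t = Term.var p := by
  cases t with
  | var p => exact ⟨p, rfl⟩
  | func f => exact isEmptyElim f

theorem exists_allowed {γ : Type*} {k : ℕ} (p : γ ⊕ Fin k) :
    ∃ F : Finset γ, p ∈ allowed F k := by
  rcases p with c | j
  · exact ⟨{c}, fun d hd => by simp [Sum.inl.inj hd]⟩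
  · exact ⟨∅, fun d hd => by simp at hd⟩

/-- The truth of a formula in a model of the theory of the random graph depends only on the
quantifier-free type of finitely many of the values of its variables. -/
theorem exists_finset_realize_iff (hM : M ⊨ randomGraphTheory) {γ : Type*} {k : ℕ}
    (φ : Language.graph.BoundedFormula γ k) :
    ∃ F : Finset γ, ∀ (v w : γ → M) (xs ys : Fin k → M),
      SamePattern (allowed F k) (Sum.elim v xs) (Sum.elim w ys) →
        (φ.Realize v xs ↔ φ.Realize w ys) := by
  classical
  induction φ with
  | falsum => exact ⟨∅, fun _ _ _ _ _ => Iff.rfl⟩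
  | equal t₁ t₂ =>
    obtain ⟨p, rfl⟩ := exists_term_var t₁
    obtain ⟨q, rfl⟩ := exists_term_var t₂
    obtain ⟨F₁, h₁⟩ := exists_allowed p
    obtain ⟨F₂, h₂⟩ := exists_allowed q
    exact ⟨F₁ ∪ F₂, fun v w xs ys h => (h p (allowed_mono Finset.subset_union_left _ h₁) q
      (allowed_mono Finset.subset_union_right _ h₂)).1⟩
  | rel R ts =>
    cases R
    obtain ⟨p, hp⟩ := exists_term_var (ts 0)
    obtain ⟨q, hq⟩ := exists_term_var (ts 1)
    obtain ⟨F₁, h₁⟩ := exists_allowed p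
    obtain ⟨F₂, h₂⟩ := exists_allowed q
    refine ⟨F₁ ∪ F₂, fun v w xs ys h => ?_⟩
    have key : ∀ (v : _ → M) (xs : _ → M), (fun i => (ts i).realize (Sum.elim v xs)) =
        ![Sum.elim v xs p, Sum.elim v xs q] := by
      intro v xs
      funext j
      fin_cases j
      · simp [hp]
      · simp [hq]
    have := (h p (allowed_mono Finset.subset_union_left _ h₁) q
      (allowed_mono Finset.subset_union_right _ h₂)).2
    rw [← key, ← key] at this
    exact this
  | imp φ ψ hφ hψ =>
    obtain ⟨F₁, h₁⟩ := hφ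
    obtain ⟨F₂, h₂⟩ := hψ
    refine ⟨F₁ ∪ F₂, fun v w xs ys h => ?_⟩
    rw [BoundedFormula.realize_imp, BoundedFormula.realize_imp,
      h₁ v w xs ys (h.mono (allowed_mono Finset.subset_union_left _)),
      h₂ v w xs ys (h.mono (allowed_mono Finset.subset_union_right _))]
  | @all k φ hφ =>
    obtain ⟨F, hF⟩ := hφ
    -- For the quantifier, a value on either side is matched on the other by
    -- `SamePattern.exists_extend`; this claim says that the enlarged tuples still have the same
    -- pattern.
    have hsnoc : ∀ (v w : _ → M) (xs ys : Fin k → M) (x y : M),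
        SamePattern (allowed F k) (Sum.elim v xs) (Sum.elim w ys) →
        (∀ p ∈ allowed F k, (Sum.elim v xs p = x ↔ Sum.elim w ys p = y) ∧
          (RelMap adj ![Sum.elim v xs p, x] ↔ RelMap adj ![Sum.elim w ys p, y])) →
        SamePattern (allowed F (k + 1)) (Sum.elim v (Fin.snoc xs x : Fin (k + 1) → M))
          (Sum.elim w (Fin.snoc ys y : Fin (k + 1) → M)) := by
      intro v w xs ys x y h hxy
      have hcase : ∀ p ∈ allowed F (k + 1),
          (∃ q ∈ allowed F k, Sum.elim v (Fin.snoc xs x : Fin (k + 1) → M) p = Sum.elim v xs q ∧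
            Sum.elim w (Fin.snoc ys y : Fin (k + 1) → M) p = Sum.elim w ys q) ∨
          (Sum.elim v (Fin.snoc xs x : Fin (k + 1) → M) p = x ∧
            Sum.elim w (Fin.snoc ys y : Fin (k + 1) → M) p = y) := by
        rintro (c | j) hp
        · exact Or.inl ⟨Sum.inl c, fun d hd => hp d (by rw [Sum.inl.inj hd]), rfl, rfl⟩
        · induction j using Fin.lastCases with
          | last => exact Or.inr (by simp)
          | cast j => exact Or.inl ⟨Sum.inr j, fun d hd => by simp at hd, by simp, by simp⟩
      intro p hp q hq
      rcases hcase p hp with ⟨p', hp', e1, e2⟩ | ⟨e1, e2⟩ <;>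
        rcases hcase q hq with ⟨q', hq', e3, e4⟩ | ⟨e3, e4⟩ <;> rw [e1, e2, e3, e4]
      · exact h p' hp' q' hq'
      · exact hxy p' hp'
      · rw [eq_comm, @eq_comm _ y, adj_comm hM, adj_comm hM y]
        exact hxy q' hq'
      · exact ⟨by simp, iff_of_false (adj_irrefl hM x) (adj_irrefl hM y)⟩
    have hsymm : ∀ (u w : _ ⊕ Fin k → M), SamePattern (allowed F k) u w →
        SamePattern (allowed F k) w u :=
      fun u w h p hp q hq => ⟨(h p hp q hq).1.symm, (h p hp q hq).2.symm⟩
    refine ⟨F, fun v w xs ys h => ?_⟩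
    rw [BoundedFormula.realize_all, BoundedFormula.realize_all]
    constructor
    · intro H y
      obtain ⟨x, hx⟩ := (hsymm _ _ h).exists_extend hM (allowed_finite F k) y
      exact (hF _ _ _ _ (hsnoc v w xs ys x y h
        (fun p hp => ⟨(hx p hp).1.symm, (hx p hp).2.symm⟩))).1 (H x)
    · intro H x
      obtain ⟨y, hy⟩ := h.exists_extend hM (allowed_finite F k) x
      exact (hF _ _ _ _ (hsnoc v w xs ys x y h hy)).2 (H y)

/-- The truth of a formula with parameters depends only on the quantifier-free type of its
arguments over finitely many parameters. -/
theorem exists_finset_parameters (hM : M ⊨ randomGraphTheory) {α : Type*}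
    (φ : Language.graph[[M]].Formula α) :
    ∃ F : Finset M, ∀ v w : α → M,
      SamePattern {p : M ⊕ α | ∀ c, p = Sum.inl c → c ∈ F} (Sum.elim id v) (Sum.elim id w) →
        (φ.Realize v ↔ φ.Realize w) := by
  classical
  -- Parameters become free variables valued by `id`; of the finite set obtained, only these are
  -- kept, all variables in `α` being compared anyway.
  obtain ⟨F, hF⟩ := exists_finset_realize_iff hM (BoundedFormula.constantsVarsEquiv φ)
  refine ⟨F.preimage Sum.inl Sum.inl_injective.injOn, fun v w h => ?_⟩
  have key : ∀ v : α → M, φ.Realize v ↔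
      (BoundedFormula.constantsVarsEquiv φ).Realize (Sum.elim id v) default := by
    intro v
    have := BoundedFormula.realize_constantsVarsEquiv (φ := φ) (v := v) (xs := default)
    exact this.symm
  rw [key, key]
  apply hF
  have hp : ∀ p ∈ allowed F 0, ∃ p' : M ⊕ α, p = Sum.inl p' ∧
      ∀ c, p' = Sum.inl c → c ∈ F.preimage Sum.inl Sum.inl_injective.injOn := by
    rintro (p | j) hp
    · refine ⟨p, rfl, fun c hc => ?_⟩
      rw [Finset.mem_preimage, ← hc]
      exact hp p rfl
    · exact j.elim0
  intro p hp₁ q hq₁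
  obtain ⟨p', rfl, hp'⟩ := hp p hp₁
  obtain ⟨q', rfl, hq'⟩ := hp q hq₁
  exact h p' hp' q' hq'

end RandomGraph

/-! ### Upper bounds -/

section UpperBound

variable {M : Type*} [Language.graph.Structure M] {anti tr : Prop}
  {K : Set (Bundled.{0} binLang.Structure)} {m n : ℕ}

/-- From a `K^{*m}`-configuration we get a finite structure with all types of pairs and an
assignment of `n`-tuples to its points such that the relations between two distinct points are
determined by the adjacency matrix of their tuples. -/
theorem exists_determined (hM : M ⊨ randomGraphTheory) (hta : tr → anti)
    (hK : IsBinClass anti tr K)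
    (hex : ExistsConfiguration (starPow K m) (trivialType Language.graph M n)) :
    ∃ (A : Type) (r : Fin m → A → A → Prop) (g : A → Fin n → M),
      (∀ k, IsBin anti tr (r k)) ∧ (∀ t : Fin m → Prop, ∃ a b, a ≠ b ∧ ∀ k, r k a b ↔ t k) ∧
      ∀ a b a' b', a ≠ b → a' ≠ b' →
        (∀ i j, RelMap adj ![g a i, g b j] ↔ RelMap adj ![g a' i, g b' j]) →
        ∀ k, r k a b ↔ r k a' b' := by
  classical
  obtain ⟨Γ, _, _, hΓ, f, -, hf⟩ := hex
  choose φ hφ using fun k : Fin m => hf 2 (starSym m k)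
  choose F hF using fun k : Fin m => exists_finset_parameters hM (φ k)
  let F' : Finset M := Finset.univ.biUnion F
  have hFF' : ∀ k, F k ⊆ F' := fun k => Finset.subset_biUnion_of_mem F (Finset.mem_univ k)
  -- The colour is the quantifier-free type of one tuple over all parameters involved; there are
  -- finitely many colours.
  let χ : (Fin n → M) → (Fin n → Fin n → Prop × Prop) × (Fin n → F' → Prop × Prop) := fun x =>
    (fun i j => (x i = x j, RelMap adj ![x i, x j]), fun i c => (x i = c, RelMap adj ![x i, (c : M)]))
  obtain ⟨A, r, hA, hr, hrich⟩ := exists_rich (anti := anti) hta (Fin m)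
  obtain ⟨B, s, hB, hs, H⟩ := (unavoidable_color (κ := Fin m) hta χ).and
    (Unavoidable.forall (P := fun (p : Fin n × Fin n) {I} (x : I → Fin n → M) =>
        CrossUniform (fun y => y p.1) (fun y => y p.2) x)
      (fun p => unavoidable_crossUniform hta _ _) (fun p => CrossUniform.isHereditary _ _))
    (fun x e _ h a b => h _ _) A r hA hr
  obtain ⟨S, hS⟩ := exists_structure m s
  have hBK : (⟨B, S⟩ : Bundled.{0} (starLang binLang m).Structure) ∈ starPow K m := by
    rw [mem_starPow hK]
    refine ⟨hB, fun k => (congrArg (IsBin anti tr) ?_).mp (hs k)⟩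
    funext a b
    exact propext (hS k a b).symm
  rw [← hΓ.age] at hBK
  obtain ⟨-, ⟨h⟩⟩ := hBK
  obtain ⟨e, he, hcol, hcross⟩ := H fun b => f (h b)
  let g : A → Fin n → M := fun a => f (h (e a))
  have hcol1 : ∀ a a' i j, (g a i = g a j ↔ g a' i = g a' j) ∧
      (RelMap adj ![g a i, g a j] ↔ RelMap adj ![g a' i, g a' j]) := by
    intro a a' i j
    have := Prod.mk.inj (congrFun (congrFun (congrArg Prod.fst (hcol a a')) i) j)
    exact ⟨iff_of_eq this.1, iff_of_eq this.2⟩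
  have hcol2 : ∀ a a' i, ∀ c ∈ F', (g a i = c ↔ g a' i = c) ∧
      (RelMap adj ![g a i, c] ↔ RelMap adj ![g a' i, c]) := by
    intro a a' i c hc
    have := Prod.mk.inj (congrFun (congrFun (congrArg Prod.snd (hcol a a')) i) ⟨c, hc⟩)
    exact ⟨iff_of_eq this.1, iff_of_eq this.2⟩
  have hcr : ∀ i j a b a' b', a ≠ b → a' ≠ b' → (g a i = g b j ↔ g a' i = g b' j) :=
    fun i j => hcross (i, j)
  refine ⟨A, r, g, hr, hrich, fun a b a' b' hab hab' hadj k => ?_⟩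
  have hreal : ∀ a b, r k a b ↔ (φ k).Realize (fun p => g ((![a, b] : Fin 2 → A) p.1) p.2) := by
    intro a b
    rw [he.iff k a b, ← hS k]
    refine ((Embedding.relMap_pair (A := B) (B := Γ) h (starSym m k) (e a) (e b)).symm.trans
      (hφ k _)).trans (iff_of_eq (congrArg _ ?_))
    funext ⟨p, i⟩
    fin_cases p <;> rfl
  rw [hreal, hreal]
  -- Within one tuple and over the parameters the colour decides, and across tuples `hcr` decides
  -- equalities; only adjacency across tuples needs the hypothesis on matrices.
  apply hF
  have hadj' : ∀ i j, RelMap adj ![g b i, g a j] ↔ RelMap adj ![g b' i, g a' j] := by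
    intro i j
    rw [adj_comm hM, hadj j i, adj_comm hM]
  have hpar : ∀ a a' i, ∀ c ∈ F', (c = g a i ↔ c = g a' i) ∧
      (RelMap adj ![c, g a i] ↔ RelMap adj ![c, g a' i]) := by
    intro a a' i c hc
    rw [adj_comm hM c, adj_comm hM c, @eq_comm _ c, @eq_comm _ c]
    exact hcol2 a a' i c hc
  rintro (c | ⟨p, i⟩) hp (d | ⟨q, j⟩) hq
  · exact ⟨Iff.rfl, Iff.rfl⟩
  · exact (by fin_cases q <;> exact hpar _ _ j c (hFF' k (hp c rfl)))
  · exact (by fin_cases p <;> exact hcol2 _ _ i d (hFF' k (hq d rfl)))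
  · fin_cases p <;> fin_cases q
    · exact hcol1 a a' i j
    · exact ⟨hcr i j a b a' b' hab hab', hadj i j⟩
    · exact ⟨hcr i j b a b' a' hab.symm hab'.symm, hadj' i j⟩
    · exact hcol1 b b' i j

theorem card_types (m : ℕ) : Fintype.card (Fin m → Prop) = 2 ^ m := by
  simp

theorem card_matrices (n : ℕ) : Fintype.card (Fin n → Fin n → Prop) = 2 ^ (n * n) := by
  simp [pow_mul]

theorem le_of_existsConfiguration (hM : M ⊨ randomGraphTheory) (hta : tr → anti)
    (hK : IsBinClass anti tr K)
    (hex : ExistsConfiguration (starPow K m) (trivialType Language.graph M n)) : m ≤ n * n := by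
  obtain ⟨A, r, g, hr, hrich, hdet⟩ := exists_determined hM hta hK hex
  choose α β hne hαβ using hrich
  have hinj : Function.Injective fun (t : Fin m → Prop) (i j : Fin n) =>
      RelMap adj ![g (α t) i, g (β t) j] := by
    intro t t' h
    funext k
    refine propext ((hαβ t k).symm.trans ((hdet _ _ _ _ (hne t) (hne t') (fun i j => ?_) k).trans
      (hαβ t' k)))
    exact iff_of_eq (congrFun (congrFun h i) j)
  have := Fintype.card_le_of_injective _ hinj
  rw [card_types, card_matrices] at this
  exact (Nat.pow_le_pow_iff_right (by norm_num)).1 this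

/-- A configuration with `n ^ 2` relations would use all matrices. -/
theorem exists_determined_surjective (hM : M ⊨ randomGraphTheory) (hta : tr → anti)
    (hK : IsBinClass anti tr K) (hm : n * n ≤ m)
    (hex : ExistsConfiguration (starPow K m) (trivialType Language.graph M n)) :
    ∃ (A : Type) (r : Fin m → A → A → Prop) (D : A → A → Fin n → Fin n → Prop),
      (∀ k, IsBin anti tr (r k)) ∧ (∀ a b i j, D a b i j ↔ D b a j i) ∧
      (∀ N : Fin n → Fin n → Prop, ∃ a b, a ≠ b ∧ D a b = N) ∧
      ∀ a b a' b', a ≠ b → a' ≠ b' → (D a b = D a' b' ↔ ∀ k, r k a b ↔ r k a' b') := by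
  have hle := le_of_existsConfiguration hM hta hK hex
  obtain ⟨A, r, g, hr, hrich, hdet⟩ := exists_determined hM hta hK hex
  let D : A → A → Fin n → Fin n → Prop := fun a b i j => RelMap adj ![g a i, g b j]
  have hdet' : ∀ a b a' b', a ≠ b → a' ≠ b' → D a b = D a' b' → ∀ k, r k a b ↔ r k a' b' :=
    fun a b a' b' hab hab' h => hdet a b a' b' hab hab'
      (fun i j => iff_of_eq (congrFun (congrFun h i) j))
  choose α β hne hαβ using hrich
  have hinj : Function.Injective fun t : Fin m → Prop => D (α t) (β t) := by
    intro t t' h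
    funext k
    exact propext ((hαβ t k).symm.trans ((hdet' _ _ _ _ (hne t) (hne t') h k).trans (hαβ t' k)))
  -- The injection from types to matrices is between sets of equal size, so every matrix determines
  -- and is determined by a type.
  have hbij := (Fintype.bijective_iff_injective_and_card _).2
    ⟨hinj, by rw [card_types, card_matrices, le_antisymm hle hm]⟩
  have hrep : ∀ a b, a ≠ b → ∃ t, D (α t) (β t) = D a b ∧ ∀ k, r k a b ↔ t k := by
    intro a b hab
    obtain ⟨t, ht⟩ := hbij.2 (D a b)
    exact ⟨t, ht, fun k => (hdet' _ _ _ _ hab (hne t) ht.symm k).trans (hαβ t k)⟩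
  refine ⟨A, r, D, hr, fun a b i j => adj_comm hM _ _, fun N => ?_,
    fun a b a' b' hab hab' => ⟨hdet' a b a' b' hab hab', fun h => ?_⟩⟩
  · obtain ⟨t, ht⟩ := hbij.2 N
    exact ⟨α t, β t, hne t, ht⟩
  · obtain ⟨t, ht, htk⟩ := hrep a b hab
    obtain ⟨t', ht', htk'⟩ := hrep a' b' hab'
    have : t = t' := by
      funext k
      exact propext ((htk k).symm.trans ((h k).trans (htk' k)))
    rw [← ht, ← ht', this]

/-- A pair with zero matrix has the same matrix after reversal, hence the same type, whereas
reversal negates every relation and there is at least one. -/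
theorem lt_of_existsConfiguration_of_anti (hM : M ⊨ randomGraphTheory) (hta : tr → anti)
    (hK : IsBinClass anti tr K) (hanti : anti) (hn : 1 ≤ n)
    (hex : ExistsConfiguration (starPow K m) (trivialType Language.graph M n)) : m < n * n := by
  by_contra! hm
  obtain ⟨A, r, D, hr, hsymm, hsurj, hdet⟩ := exists_determined_surjective hM hta hK hm hex
  obtain ⟨a, b, hab, hD⟩ := hsurj fun _ _ => False
  have hD' : D a b = D b a := by
    funext i j
    have h1 : D a b i j = False := congrFun (congrFun hD i) j
    have h2 : D a b j i = False := congrFun (congrFun hD j) i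
    rw [h1, ← h2]
    exact propext (hsymm a b j i)
  have hpos : 0 < m := lt_of_lt_of_le (Nat.mul_pos hn hn) hm
  have h1 := (hdet a b b a hab hab.symm).1 hD' ⟨0, hpos⟩
  have h2 := (hr ⟨0, hpos⟩).swap a b hab
  simp only [hanti, not_true_eq_false, iff_false] at h2
  tauto

/-- Reversal preserves the type and would therefore preserve the matrix, but a matrix with a single
off-diagonal entry differs from its transpose. -/
theorem lt_of_existsConfiguration_of_not_anti (hM : M ⊨ randomGraphTheory) (hta : tr → anti)
    (hK : IsBinClass anti tr K) (hanti : ¬ anti) (hn : 2 ≤ n)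
    (hex : ExistsConfiguration (starPow K m) (trivialType Language.graph M n)) : m < n * n := by
  by_contra! hm
  obtain ⟨A, r, D, hr, hsymm, hsurj, hdet⟩ := exists_determined_surjective hM hta hK hm hex
  let i₀ : Fin n := ⟨0, by lia⟩
  let i₁ : Fin n := ⟨1, by lia⟩
  obtain ⟨a, b, hab, hD⟩ := hsurj fun i j => i = i₀ ∧ j = i₁
  have hD' : D a b = D b a := (hdet a b b a hab hab.symm).2 fun k => by
    simpa [hanti] using ((hr k).swap a b hab).symm
  have h1 : D a b i₀ i₁ := by
    rw [hD]
    exact ⟨rfl, rfl⟩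
  have h2 : D a b i₁ i₀ := by
    rw [hsymm, ← hD']
    exact h1
  rw [hD] at h2
  exact absurd (congrArg Fin.val h2.1) (by simp [i₀, i₁])

end UpperBound

/-! ### Lower bounds -/

section LowerBound

variable {M : Type*} [Language.graph.Structure M] {anti tr : Prop}
  {K : Set (Bundled.{0} binLang.Structure)} {m n : ℕ}

/-- Every property of the adjacency matrix of two `n`-tuples is definable. -/
theorem exists_formula_matrix (Q : (Fin n → Fin n → Prop) → Prop) :
    ∃ φ : Language.graph.Formula (Fin 2 × Fin n), ∀ v : Fin 2 × Fin n → M,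
      φ.Realize v ↔ Q fun i j => RelMap adj ![v (0, i), v (1, j)] := by
  classical
  let ψ : Fin n × Fin n → Language.graph.Formula (Fin 2 × Fin n) := fun p =>
    adj.formula₂ (Term.var (0, p.1)) (Term.var (1, p.2))
  have hψ : ∀ p (v : Fin 2 × Fin n → M),
      (ψ p).Realize v ↔ RelMap adj ![v (0, p.1), v (1, p.2)] := fun p v => by
    simp [ψ, Formula.realize_rel₂]
  refine ⟨Formula.iSup fun N : {N // Q N} => Formula.iInf fun p : Fin n × Fin n =>
    if N.1 p.1 p.2 then ψ p else ∼(ψ p), fun v => ?_⟩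
  have key : ∀ N : Fin n → Fin n → Prop, ∀ p : Fin n × Fin n,
      (if N p.1 p.2 then ψ p else ∼(ψ p)).Realize v ↔
        (N p.1 p.2 ↔ RelMap adj ![v (0, p.1), v (1, p.2)]) := by
    intro N p
    split_ifs with h
    · simp [h, hψ]
    · simp [h, hψ, Formula.realize_not]
  simp only [Formula.realize_iSup, Formula.realize_iInf, key]
  constructor
  · rintro ⟨N, hN⟩
    convert N.2 using 1
    funext i j
    exact propext (hN (i, j)).symm
  · exact fun h => ⟨⟨_, h⟩, fun _ => Iff.rfl⟩

/-- The point `a` becomes the tuple of vertices `(a, i)`, with `D a b` as the adjacency matrix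
between two fibres and no edges inside a fibre. -/
theorem existsConfiguration_of_coding (hM : M ⊨ randomGraphTheory) (hta : tr → anti)
    (hK : IsBinClass anti tr K) (i₀ : Fin n) (dec : (Fin n → Fin n → Prop) → Fin m → Prop)
    (H : ∀ R : Fin m → ℕ → ℕ → Prop, (∀ k, IsBin anti tr (R k)) →
      ∃ D : ℕ → ℕ → Fin n → Fin n → Prop, (∀ a b, a ≠ b → ∀ i j, D a b i j ↔ D b a j i) ∧
        ∀ a b, a ≠ b → ∀ k, R k a b ↔ dec (D a b) k) :
    ExistsConfiguration (starPow K m) (trivialType Language.graph M n) := by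
  obtain ⟨S, hlim, hbin⟩ := exists_fraisseLimit hta hK m
  obtain ⟨D, hsymm, hD⟩ := H _ hbin
  let G : SimpleGraph (ℕ × Fin n) :=
    { Adj := fun x y => x.1 ≠ y.1 ∧ D x.1 y.1 x.2 y.2
      symm := ⟨fun x y h => ⟨h.1.symm, (hsymm _ _ h.1 _ _).1 h.2⟩⟩
      loopless := ⟨fun x h => h.1 rfl⟩ }
  obtain ⟨f, hf, hfG⟩ := exists_graph_embedding hM G
  refine ⟨ℕ, S, inferInstance, hlim, fun a i => f (a, i), ?_, ?_⟩
  · rintro a _ ⟨i, rfl⟩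
    simp [Formula.Realize, Term.equal]
  · refine exhausts_starSym m (fun k R => ∃ φ : Language.graph[[M]].Formula (Fin k × Fin n),
      ∀ a : Fin k → ℕ, RelMap R a ↔ φ.Realize (fun p => f (a p.1, p.2))) fun k => ?_
    obtain ⟨φ, hφ⟩ := exists_formula_matrix (M := M) (n := n) fun N => dec N k
    -- The decoder may accept the zero matrix of a point with itself, so equal points are excluded
    -- by comparing one coordinate.
    let ψ : Language.graph.Formula (Fin 2 × Fin n) :=
      ∼(Term.equal (Term.var (0, i₀)) (Term.var (1, i₀))) ⊓ φ
    refine ⟨(Language.graph.lhomWithConstants M).onFormula ψ, fun a => ?_⟩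
    rw [LHom.realize_onFormula, Formula.realize_inf, Formula.realize_not, Formula.realize_equal, hφ]
    have ha : a = ![a 0, a 1] := by
      funext j
      fin_cases j <;> rfl
    simp only [Term.realize_var, hfG, hf.eq_iff, Prod.mk.injEq, and_true, G]
    rw [ha]
    by_cases hab : a 0 = a 1
    · simp only [hab, Matrix.cons_val_zero, Matrix.cons_val_one, not_true_eq_false, false_and,
        iff_false]
      exact (hbin k).irrefl (a 1)
    · simpa [hab] using hD (a 0) (a 1) hab k

/-- Relation `k` is written in cell `p k`, always for the order of the pair in which `k₀` holds. As
`k₀` occupies `(i₀, i₁)` and `(i₁, i₀)` stays empty, the entry at `(i₀, i₁)` tells whether the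
matrix is read in that order or transposed. -/
theorem existsConfiguration_of_anti (hM : M ⊨ randomGraphTheory) (hta : tr → anti)
    (hK : IsBinClass anti tr K) (hanti : anti) (hm : 1 ≤ m) (hmn : m < n * n) :
    ExistsConfiguration (starPow K m) (trivialType Language.graph M n) := by
  classical
  have hn : 2 ≤ n := by
    by_contra! h
    interval_cases n <;> lia
  let i₀ : Fin n := ⟨0, by lia⟩
  let i₁ : Fin n := ⟨1, by lia⟩
  have h01 : i₀ ≠ i₁ := by simp [i₀, i₁]
  let k₀ : Fin m := ⟨0, by lia⟩
  obtain ⟨p, hp, hp0, hp1⟩ : ∃ p : Fin m → Fin n × Fin n, Function.Injective p ∧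
      p k₀ = (i₀, i₁) ∧ ∀ k, p k ≠ (i₁, i₀) := by
    have hcard : Fintype.card (Fin m) ≤ Fintype.card {q : Fin n × Fin n // q ≠ (i₁, i₀)} := by
      rw [Fintype.card_subtype_compl, Fintype.card_subtype_eq]
      simp only [Fintype.card_fin, Fintype.card_prod]
      lia
    obtain ⟨p⟩ := Function.Embedding.nonempty_of_card_le hcard
    let q₀ : {q : Fin n × Fin n // q ≠ (i₁, i₀)} :=
      ⟨(i₀, i₁), fun h => h01 (Prod.mk.inj h).1⟩
    -- A transposition of cells moves `k₀` to its prescribed cell and preserves injectivity.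
    refine ⟨fun k => (Equiv.swap (p k₀) q₀ (p k) : Fin n × Fin n), fun k k' h => ?_, ?_,
      fun k => (Equiv.swap (p k₀) q₀ (p k)).2⟩
    · exact p.injective ((Equiv.swap (p k₀) q₀).injective (Subtype.ext h))
    · simp [q₀]
  refine existsConfiguration_of_coding hM hta hK i₀
    (fun N k => (N i₀ i₁ ∧ N (p k).1 (p k).2) ∨ (¬ N i₀ i₁ ∧ ¬ N (p k).2 (p k).1)) fun R hR => ?_
  refine ⟨fun a b i j => (R k₀ a b ∧ ∃ k, p k = (i, j) ∧ R k a b) ∨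
    (R k₀ b a ∧ ∃ k, p k = (j, i) ∧ R k b a), fun a b _ i j => or_comm, fun a b hab k => ?_⟩
  have hsw : ∀ k, R k b a ↔ ¬ R k a b := fun k => by simpa [hanti] using (hR k).swap a b hab
  have hex : ∀ a b, (∃ k', p k' = p k ∧ R k' a b) ↔ R k a b := fun a b =>
    ⟨fun ⟨k', h, h'⟩ => hp h ▸ h', fun h => ⟨k, rfl, h⟩⟩
  have hex0 : ∀ a b, (∃ k', p k' = (i₀, i₁) ∧ R k' a b) ↔ R k₀ a b := fun a b =>
    ⟨fun ⟨k', h, h'⟩ => hp (h.trans hp0.symm) ▸ h', fun h => ⟨k₀, hp0, h⟩⟩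
  by_cases h0 : R k₀ a b
  · have h0' : ¬ R k₀ b a := fun h => (hsw k₀).1 h h0
    simp only [h0, h0', true_and, false_and, or_false, Prod.mk.eta, hex, hex0, not_true_eq_false]
  · have h0' : R k₀ b a := (hsw k₀).2 h0
    simp only [h0, h0', true_and, false_and, false_or, Prod.mk.eta, hex, hp1, exists_false,
      not_false_eq_true]
    rw [hsw, not_not]

/-- The order of `ℕ` decides which of `g t` and its transpose is used for a pair. The decoder cannot
see this order, but it needs only the transposition orbit, which determines `t` by `hg`. -/
theorem existsConfiguration_of_injective (hM : M ⊨ randomGraphTheory) (hta : tr → anti)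
    (hK : IsBinClass anti tr K) (hanti : ¬ anti) (hn : 1 ≤ n)
    (g : (Fin m → Prop) → Fin n → Fin n → Prop)
    (hg : ∀ t t', (g t = g t' ∨ g t = fun i j => g t' j i) → t = t') :
    ExistsConfiguration (starPow K m) (trivialType Language.graph M n) := by
  refine existsConfiguration_of_coding hM hta hK ⟨0, hn⟩
    (fun N k => ∃ t, (g t = N ∨ g t = fun i j => N j i) ∧ t k) fun R hR => ?_
  have hsw : ∀ a b, a ≠ b → (fun k => R k b a) = fun k => R k a b := by
    intro a b hab
    funext k
    exact propext (by simpa [hanti] using (hR k).swap a b hab)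
  refine ⟨fun a b i j => (a < b ∧ g (fun k => R k a b) i j) ∨ (b < a ∧ g (fun k => R k b a) j i),
    fun a b _ i j => or_comm, fun a b hab k => ?_⟩
  rcases lt_or_gt_of_ne hab with h | h
  · simp only [h, h.not_gt, true_and, false_and, or_false]
    constructor
    · exact fun hk => ⟨fun k => R k a b, Or.inl rfl, hk⟩
    · rintro ⟨t, ht, htk⟩
      rwa [hg _ _ ht] at htk
  · simp only [h, h.not_gt, true_and, false_and, false_or, hsw a b hab]
    constructor
    · exact fun hk => ⟨fun k => R k a b, Or.inr rfl, hk⟩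
    · rintro ⟨t, ht, htk⟩
      rwa [hg _ _ ht.symm] at htk

/-- Orbits of transposition have at most two elements, so at least half of the `2 ^ (n * n)`
matrices, hence at least `2 ^ m`, serve as orbit representatives: those numbered no later than their
transpose. -/
theorem existsConfiguration_of_not_anti (hM : M ⊨ randomGraphTheory) (hta : tr → anti)
    (hK : IsBinClass anti tr K) (hanti : ¬ anti) (hmn : m < n * n) :
    ExistsConfiguration (starPow K m) (trivialType Language.graph M n) := by
  classical
  have hn : 1 ≤ n := by
    by_contra! h
    interval_cases n
    lia
  let ρ := Fintype.equivFin (Fin n → Fin n → Prop)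
  let T : (Fin n → Fin n → Prop) → Fin n → Fin n → Prop := fun N i j => N j i
  let S : Finset (Fin n → Fin n → Prop) := Finset.univ.filter fun N => ρ N ≤ ρ (T N)
  have hS : (Finset.univ : Finset (Fin n → Fin n → Prop)) ⊆ S ∪ S.image T := by
    intro N _
    rcases le_total (ρ N) (ρ (T N)) with h | h
    · exact Finset.mem_union_left _ (Finset.mem_filter.2 ⟨Finset.mem_univ N, h⟩)
    · exact Finset.mem_union_right _
        (Finset.mem_image.2 ⟨T N, Finset.mem_filter.2 ⟨Finset.mem_univ _, h⟩, rfl⟩)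
  have hcard : Fintype.card (Fin m → Prop) ≤ Fintype.card S := by
    have h1 : 2 ^ (n * n) ≤ S.card + S.card := by
      rw [← card_matrices, ← Finset.card_univ]
      exact (Finset.card_le_card hS).trans ((Finset.card_union_le _ _).trans
        (Nat.add_le_add_left Finset.card_image_le _))
    have h2 : 2 ^ (m + 1) ≤ 2 ^ (n * n) := Nat.pow_le_pow_right (by norm_num) hmn
    rw [card_types, Fintype.card_coe]
    rw [pow_succ] at h2
    lia
  obtain ⟨g⟩ := Function.Embedding.nonempty_of_card_le hcard
  refine existsConfiguration_of_injective hM hta hK hanti hn (fun t => (g t).1) fun t t' h => ?_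
  apply g.injective
  apply Subtype.ext
  rcases h with h | h
  · exact h
  · have h1 : ρ (g t).1 ≤ ρ (T (g t).1) := (Finset.mem_filter.1 (g t).2).2
    have h2 : ρ (g t').1 ≤ ρ (T (g t').1) := (Finset.mem_filter.1 (g t').2).2
    have h3 : (g t).1 = T (g t').1 := h
    have h4 : T (g t).1 = (g t').1 := by rw [h3]
    rw [h4] at h1
    rw [← h3] at h2
    exact ρ.injective (le_antisymm h1 h2)

end LowerBound

/-! ### Values of the ranks -/

theorem hasRank_iff {L : FirstOrder.Language} {M : Type*} [L.Structure M]
    {K : Set (Bundled.{0} binLang.Structure)} {β : Type} {π : Set (L[[M]].Formula β)} {N : ℕ}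
    (h : ∀ m, 1 ≤ m → (ExistsConfiguration (starPow K m) π ↔ m ≤ N)) (r : ℕ∞) :
    HasRank K π r ↔ r = N := by
  -- `K^{*1}` is `K` by definition, so the clause for rank `0` is the case `m = 1`.
  have h1 : ExistsConfiguration K π ↔ 1 ≤ N := h 1 le_rfl
  constructor
  · rintro (⟨rfl, h0⟩ | ⟨m, hm, rfl, hex, hnex⟩ | ⟨-, htop⟩)
    · rw [h1] at h0
      have : N = 0 := by lia
      simp [this]
    · rw [h m hm] at hex
      rw [h (m + 1) (by lia)] at hnex
      have : m = N := by lia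
      rw [this]
    · have := (h (N + 1) (by lia)).1 (htop (N + 1) (by lia))
      lia
  · rintro rfl
    rcases Nat.eq_zero_or_pos N with rfl | hN
    · exact Or.inl ⟨by simp, by rw [h1]; lia⟩
    · refine Or.inr (Or.inl ⟨N, hN, rfl, (h N hN).2 le_rfl, ?_⟩)
      rw [h (N + 1) (by lia)]
      lia

theorem hasRank_iff_of_anti {M : Type*} [Language.graph.Structure M] {anti tr : Prop}
    {K : Set (Bundled.{0} binLang.Structure)} (hM : M ⊨ randomGraphTheory) (hta : tr → anti)
    (hK : IsBinClass anti tr K) (hanti : anti) {n : ℕ} (hn : 1 ≤ n) (r : ℕ∞) :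
    HasRank K (trivialType Language.graph M n) r ↔ r = ((n ^ 2 - 1 : ℕ) : ℕ∞) := by
  refine hasRank_iff (fun m hm => ?_) r
  have hpos : 0 < n * n := Nat.mul_pos hn hn
  constructor
  · intro h
    have := lt_of_existsConfiguration_of_anti hM hta hK hanti hn h
    rw [sq]
    lia
  · intro h
    rw [sq] at h
    exact existsConfiguration_of_anti hM hta hK hanti hm (by lia)

theorem hasRank_Gr_iff {M : Type*} [Language.graph.Structure M] (hM : M ⊨ randomGraphTheory)
    {n : ℕ} (hn : 1 ≤ n) (r : ℕ∞) :
    HasRank Gr (trivialType Language.graph M n) r ↔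
      r = if n = 1 then 1 else ((n ^ 2 - 1 : ℕ) : ℕ∞) := by
  by_cases h1 : n = 1
  · subst h1
    rw [if_pos rfl, ← Nat.cast_one]
    refine hasRank_iff (fun m hm => ⟨fun h => ?_, fun h => ?_⟩) r
    · exact le_of_existsConfiguration hM id isBinClass_Gr h
    · have : m = 1 := le_antisymm h hm
      subst this
      refine existsConfiguration_of_injective hM id isBinClass_Gr not_false le_rfl
        (fun t _ _ => t 0) fun t t' h => ?_
      funext k
      rw [Subsingleton.elim k 0]
      rcases h with h | h <;> exact congrFun (congrFun h 0) 0
  · rw [if_neg h1]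
    refine hasRank_iff (fun m hm => ?_) r
    have hpos : 0 < n * n := Nat.mul_pos hn hn
    constructor
    · intro h
      have := lt_of_existsConfiguration_of_not_anti hM id isBinClass_Gr not_false (by lia) h
      rw [sq]
      lia
    · intro h
      rw [sq] at h
      exact existsConfiguration_of_not_anti hM id isBinClass_Gr not_false (by lia)

end KRank

/-- Let `M` be a monster model (any `ℵ₁`-saturated model) of the theory of the random graph. For
each `n ≥ 1`, the type `y = y` in `n` variables has a unique linear order rank, tournament rank and
graph rank, and these ranks are as stated. -/
theorem mainTheorem3 {M : Type*} [FirstOrder.Language.graph.Structure M]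
    (hM : M ⊨ KRank.randomGraphTheory)
    (hsat : KRank.IsAlephOneSaturated FirstOrder.Language.graph M)
    (n : ℕ) (hn : 1 ≤ n) :
    (∀ r : ℕ∞, KRank.HasRank KRank.LO (KRank.trivialType FirstOrder.Language.graph M n) r ↔
      r = ((n ^ 2 - 1 : ℕ) : ℕ∞)) ∧
    (∀ r : ℕ∞, KRank.HasRank KRank.Tour (KRank.trivialType FirstOrder.Language.graph M n) r ↔
      r = ((n ^ 2 - 1 : ℕ) : ℕ∞)) ∧
    (∀ r : ℕ∞, KRank.HasRank KRank.Gr (KRank.trivialType FirstOrder.Language.graph M n) r ↔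
      r = if n = 1 then 1 else ((n ^ 2 - 1 : ℕ) : ℕ∞)) := by
  exact ⟨fun r => KRank.hasRank_iff_of_anti hM id KRank.isBinClass_LO trivial hn r,
    fun r => KRank.hasRank_iff_of_anti hM False.elim KRank.isBinClass_Tour trivial hn r,
    fun r => KRank.hasRank_Gr_iff hM hn r⟩
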